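/- Let $k\ge 3$ be an integer. For $N$ with $kN$ even, let $G$ be a uniformly random simple $k$-regular graph on the vertex set $\{1,\dots,N\}$. Geodesic routing on a finite graph $G$ with graph distance $d$: for each unordered pair of distinct vertices of $G$ one unit of flow is sent from one of the two vertices, $s$, to the other, $t$ (which of the two is the source is chosen arbitrarily, separately for each pair); the flow out of any vertex $u\neq t$ is split equally among the neighbours $x$ of $u$ with $d(x,t)=d(u,t)-1$; a pair in different components carries no flow. The flow $T(v)$ through a vertex $v$ is the sum, over all pairs, of the amount of flow that passes through $v$, including the full unit of each pair of which $v$ is an end point, and $M_v(N)=\max_v T(v)$ is the maximum vertex flow. Then there are a constant $C=C(k)$, not depending on $N$, and a function $g=g_k:\mathbb N\to\mathbb R$ with $g(N)=o(N\log_k^3 N)$ as $N\to\infty$, such that, with probability tending to $1$ as $N\to\infty$ through the integers with $kN$ even, $G$ is connected and, for every choice of sources, $$M_v(N) < k^{C}\,N\log_k^3(N)+g(N).$$ -/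

import Mathlib

/-! Geodesic traffic flow on finite graphs and uniformly random regular graphs. -/

noncomputable section

namespace GeodesicFlow

variable {V : Type*} [Fintype V]

open Classical in
/-- The neighbours of `u` that are one step closer to the target `t` than `u` is. -/
def nextHops (G : SimpleGraph V) (t u : V) : Finset V :=
  {x | G.Adj u x ∧ G.dist x t + 1 = G.dist u t}

open Classical in
/-- The amount of a unit flow sent from `s` towards `t` that is at a given vertex after `n` hops.
The flow out of a vertex `u` is split equally among the neighbours of `u` closer to `t`. -/
def mass (G : SimpleGraph V) (s t : V) : ℕ → V → ℝ
  | 0 => fun v => if v = s then 1 else 0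
  | n + 1 => fun v =>
      ∑ u : V, if v ∈ nextHops G t u then mass G s t n u / (nextHops G t u).card else 0

open Classical in
/-- The amount of the unit flow from `s` to `t` that passes through `v` (end points included):
the total over all hops `0, 1, …, d(s, t)`.  A pair in different components carries no flow. -/
def pairFlow (G : SimpleGraph V) (s t v : V) : ℝ :=
  if G.Reachable s t then ∑ n ∈ Finset.range (G.dist s t + 1), mass G s t n v else 0

/-- `r` chooses, for each unordered pair of distinct vertices, which of the two is the source
(`r s t` says that the unit flow of the pair `{s, t}` goes from `s` to `t`). -/
def IsPairOrientation (r : V → V → Prop) : Prop :=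
  (∀ s, ¬ r s s) ∧ ∀ s t, s ≠ t → (r s t ↔ ¬ r t s)

open Classical in
/-- The total traffic flow through `v`, with one unit of flow for each unordered pair of distinct
vertices, directed according to `r`. -/
def vertexFlow (G : SimpleGraph V) (r : V → V → Prop) (v : V) : ℝ :=
  ∑ s : V, ∑ t : V, if r s t then pairFlow G s t v else 0

/-- The maximum vertex flow under geodesic routing. -/
def maxVertexFlow (G : SimpleGraph V) (r : V → V → Prop) : ℝ :=
  ⨆ v : V, vertexFlow G r v

open Classical in
/-- The simple `k`-regular graphs on the labelled vertex set `Fin N`. -/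
def regularGraphs (k N : ℕ) : Set (SimpleGraph (Fin N)) :=
  {G | G.IsRegularOfDegree k}

/-- The probability that a uniformly random `k`-regular graph on `Fin N` has the property `P`. -/
def regularProb (k N : ℕ) (P : SimpleGraph (Fin N) → Prop) : ℝ :=
  ({G ∈ regularGraphs k N | P G}.ncard : ℝ) / ((regularGraphs k N).ncard : ℝ)

end GeodesicFlow

end

/-! Flow from `s` to `t` meets `v` only if `v` lies on a geodesic, and one pair sends at most one
unit through `v`. If the diameter is at most `D`, the pairs routed through `v` have `s` at some
distance `a` from `v` and `t` within `D - a`. There are at most `8 * (k - 1) ^ D` of these for each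
`a`, whence `vertexFlow_le`. It remains to find `D = 2 * r + 1 = O(log N)` with `(k - 1) ^ D = O(N
log² N)` such that almost every `k`-regular graph has diameter at most `D`.

Uniform regular graphs are handled by switchings: replacing two edges `ab`, `cd` by `ac`, `bd` and
counting both ways compares the sizes of two classes of graphs. (1) Given edges are jointly present
with probability at most `2k/N` per edge (`card_regsWith_le`). By a union bound, sets of up to order
`N ^ (3/4)` vertices span at most `1 + ε` edges per vertex, with `ε` of order `1 / log N`
(`card_not_isSparse_le`). (2) Balls then grow by a factor at least `k - 1 - k * ε` per step; over
`O(log N)` steps this loses only a constant against `(k - 1) ^ r` (`IsSparse.pow_le_card_ball`,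
`exp_mul_pow_le`). (3) Two balls with of order `√N log N` outgoing edges each are, outside
probability `N⁻³`, joined by an edge or overlapping (`card_farClass_zero_le`); a union bound over
pairs gives the diameter. -/

noncomputable section

namespace GeodesicFlow

open Finset

open scoped Classical

/-! ### Switchings of regular graphs -/

section Switch

variable {V : Type*}

/-- Replace the edges `ab`, `cd` by the edges `ac`, `bd`. -/
def switch (G : SimpleGraph V) (a b c d : V) : SimpleGraph V :=
  (G \ SimpleGraph.fromEdgeSet {s(a, b), s(c, d)}) ⊔ SimpleGraph.fromEdgeSet {s(a, c), s(b, d)}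

/-- The edges `ab`, `cd` of `G` can be replaced by the new edges `ac`, `bd`. -/
structure Switchable (G : SimpleGraph V) (a b c d : V) : Prop where
  ab : G.Adj a b
  cd : G.Adj c d
  nac : ¬ G.Adj a c
  nbd : ¬ G.Adj b d
  ac : a ≠ c
  bd : b ≠ d

lemma switch_adj {G : SimpleGraph V} {a b c d : V} (u v : V) :
    (switch G a b c d).Adj u v ↔
      (G.Adj u v ∧ s(u, v) ≠ s(a, b) ∧ s(u, v) ≠ s(c, d)) ∨
        (u ≠ v ∧ (s(u, v) = s(a, c) ∨ s(u, v) = s(b, d))) := by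
  have := G.ne_of_adj (a := u) (b := v)
  simp only [switch, SimpleGraph.sup_adj, SimpleGraph.sdiff_adj, SimpleGraph.fromEdgeSet_adj,
    Set.mem_insert_iff, Set.mem_singleton_iff]
  tauto

namespace Switchable

variable {G : SimpleGraph V} {a b c d : V}

lemma swap (h : Switchable G a b c d) : Switchable G b a d c :=
  ⟨h.ab.symm, h.cd.symm, h.nbd, h.nac, h.bd, h.ac⟩

lemma flip (h : Switchable G a b c d) : Switchable G c d a b :=
  ⟨h.cd, h.ab, fun e => h.nac e.symm, fun e => h.nbd e.symm, h.ac.symm, h.bd.symm⟩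

lemma ad (h : Switchable G a b c d) : a ≠ d := by
  rintro rfl; exact h.nac h.cd.symm

lemma bc (h : Switchable G a b c d) : b ≠ c := by
  rintro rfl; exact h.nac h.ab

end Switchable

lemma switch_swap (G : SimpleGraph V) (a b c d : V) : switch G a b c d = switch G b a d c := by
  ext u v
  rw [switch_adj, switch_adj, Sym2.eq_swap (a := a) (b := b), Sym2.eq_swap (a := c) (b := d)]
  tauto

lemma switch_flip (G : SimpleGraph V) (a b c d : V) : switch G a b c d = switch G c d a b := by
  ext u v
  rw [switch_adj, switch_adj, Sym2.eq_swap (a := a) (b := c), Sym2.eq_swap (a := b) (b := d)]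
  tauto

/-- The four vertices and the outcome thus determine the original graph, which is the injectivity
needed for double counting. -/
lemma switch_switch {G : SimpleGraph V} {a b c d : V} (h : Switchable G a b c d) :
    switch (switch G a b c d) a c b d = G := by
  obtain ⟨h1, h2, h3, h4, h5, h6⟩ := h
  have := h1.symm
  have := h2.symm
  have := fun e => h3 (G.adj_symm e)
  have := fun e => h4 (G.adj_symm e)
  ext u v
  have := G.ne_of_adj (a := u) (b := v)
  simp only [switch_adj, Sym2.eq_iff, ne_eq]
  constructor
  · grind
  · grind

lemma switch_injective {G G' : SimpleGraph V} {a b c d : V} (h : Switchable G a b c d)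
    (h' : Switchable G' a b c d) (e : switch G a b c d = switch G' a b c d) : G = G' := by
  rw [← switch_switch h, e, switch_switch h']

lemma switch_adj_of_ne {G : SimpleGraph V} {a b c d z : V} (ha : z ≠ a) (hb : z ≠ b) (hc : z ≠ c)
    (hd : z ≠ d) (v : V) : (switch G a b c d).Adj z v ↔ G.Adj z v := by
  simp only [switch_adj, Sym2.eq_iff, ne_eq]
  grind

variable [Fintype V]

/-- The neighbours of `v` as a finset, with classical decidability. -/
def nbr (G : SimpleGraph V) (v : V) : Finset V := {w | G.Adj v w}

@[simp] lemma mem_nbr {G : SimpleGraph V} {v w : V} : w ∈ nbr G v ↔ G.Adj v w := by simp [nbr]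

/-- The finite set of `k`-regular graphs on `V`. -/
def regs (V : Type*) [Fintype V] (k : ℕ) : Finset (SimpleGraph V) := {G | ∀ v, #(nbr G v) = k}

@[simp] lemma mem_regs {k : ℕ} {G : SimpleGraph V} : G ∈ regs V k ↔ ∀ v, #(nbr G v) = k := by
  simp [regs]

lemma card_nbr_switch_left {G : SimpleGraph V} {a b c d : V} (h : Switchable G a b c d) :
    #(nbr (switch G a b c d) a) = #(nbr G a) := by
  have e : nbr (switch G a b c d) a = insert c ((nbr G a).erase b) := by
    ext v
    have := h.ac; have := h.ad; have := h.bd; have := h.bc; have := h.ab.ne; have := h.cd.ne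
    simp only [mem_nbr, mem_insert, mem_erase, switch_adj, Sym2.eq_iff, ne_eq]
    grind
  rw [e, card_insert_of_notMem, card_erase_add_one]
  · simpa using h.ab
  · simp [h.nac]

lemma switch_mem_regs {k : ℕ} {G : SimpleGraph V} {a b c d : V} (h : Switchable G a b c d)
    (hG : G ∈ regs V k) : switch G a b c d ∈ regs V k := by
  rw [mem_regs] at *
  intro v
  by_cases ha : v = a
  · subst ha; rw [card_nbr_switch_left h, hG]
  by_cases hb : v = b
  · subst hb; rw [switch_swap, card_nbr_switch_left h.swap, hG]
  by_cases hc : v = c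
  · subst hc; rw [switch_flip, card_nbr_switch_left h.flip, hG]
  by_cases hd : v = d
  · subst hd; rw [switch_swap, switch_flip, card_nbr_switch_left h.swap.flip, hG]
  · rw [← hG v]
    congr 1
    ext w
    simp [switch_adj_of_ne ha hb hc hd]

end Switch

/-- Double counting of moves: `P a` holds the moves available at `a`, and `Q b` contains every move
that can have led to `b`. Since a move and its outcome determine the origin, the pairs (origin,
move) inject into the pairs (outcome, move). -/
lemma card_mul_le_card_mul_of_injOn {α β γ : Type*} (A : Finset α) (B : Finset β)
    (P : α → Finset γ) (Q : β → Finset γ) (f : γ → α → β)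
    (hf : ∀ a ∈ A, ∀ c ∈ P a, f c a ∈ B ∧ c ∈ Q (f c a))
    (inj : ∀ a ∈ A, ∀ a' ∈ A, ∀ c ∈ P a, c ∈ P a' → f c a = f c a' → a = a')
    {l u : ℕ} (hl : ∀ a ∈ A, l ≤ #(P a)) (hu : ∀ b ∈ B, #(Q b) ≤ u) :
    #A * l ≤ #B * u := by
  calc #A * l ≤ ∑ a ∈ A, #(P a) := by simpa using card_nsmul_le_sum A _ l hl
    _ = #(A.sigma P) := (card_sigma _ _).symm
    _ ≤ #(B.sigma Q) := by
        refine card_le_card_of_injOn (fun p => ⟨f p.2 p.1, p.2⟩) ?_ ?_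
        · rintro ⟨a, c⟩ h
          simp only [coe_sigma, Set.mem_sigma_iff, mem_coe] at h
          simpa using hf a h.1 c h.2
        · rintro ⟨a, c⟩ h ⟨a', c'⟩ h' e
          simp only [coe_sigma, Set.mem_sigma_iff, mem_coe] at h h'
          simp only [Sigma.mk.injEq, heq_eq_eq] at e
          obtain ⟨e, rfl⟩ := e
          rw [inj a h.1 a' h'.1 c h.2 h'.2 e]
    _ = ∑ b ∈ B, #(Q b) := card_sigma _ _
    _ ≤ #B * u := by simpa using sum_le_card_nsmul B _ u hu

lemma card_pairs_le {V : Type*} (F : Finset (Sym2 V)) (D : Finset (V × V)) :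
    #{p ∈ D | s(p.1, p.2) ∈ F} ≤ 2 * #F := by
  have := card_le_mul_card_image_of_maps_to (s := {p ∈ D | s(p.1, p.2) ∈ F}) (t := F)
    (f := fun p => s(p.1, p.2)) (by intro p hp; simpa using (mem_filter.1 hp).2) 2 (by
      intro e _
      induction e with | _ x y =>
      refine (card_le_card (t := {(x, y), (y, x)}) ?_).trans card_le_two
      rintro ⟨p, q⟩ hp
      simp only [mem_filter, Sym2.eq_iff] at hp
      simp only [mem_insert, mem_singleton, Prod.mk.injEq]
      exact hp.2)
  exact this

/-! ### Probability that prescribed edges are present -/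

section Containment

variable {V : Type*} [Fintype V]

/-- The `k`-regular graphs that contain all edges in `F`. -/
def regsWith (k : ℕ) (F : Finset (Sym2 V)) : Finset (SimpleGraph V) :=
  {G ∈ regs V k | ∀ e ∈ F, e ∈ G.edgeSet}

/-- The ordered adjacent pairs of `G`. -/
def darts (G : SimpleGraph V) : Finset (V × V) := {p | G.Adj p.1 p.2}

lemma card_darts_fst {k : ℕ} {G : SimpleGraph V} (hG : G ∈ regs V k) (S : Finset V) :
    #{p ∈ darts G | p.1 ∈ S} = k * #S := by
  have : {p ∈ darts G | p.1 ∈ S} = (S.sigma (nbr G)).map (Equiv.sigmaEquivProd V V).toEmbedding := by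
    ext ⟨a, b⟩
    simp only [darts, mem_filter, mem_univ, true_and, mem_map_equiv]
    simp [Equiv.sigmaEquivProd, and_comm]
  rw [this, card_map, card_sigma, sum_congr rfl (fun v _ => mem_regs.1 hG v), sum_const,
    smul_eq_mul, mul_comm]

lemma card_darts_snd {k : ℕ} {G : SimpleGraph V} (hG : G ∈ regs V k) (S : Finset V) :
    #{p ∈ darts G | p.2 ∈ S} = k * #S := by
  rw [← card_darts_fst hG S]
  refine card_bij' (fun p _ => p.swap) (fun p _ => p.swap) ?_ ?_ ?_ ?_ <;>
    simp [darts, SimpleGraph.adj_comm]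

lemma card_darts {k : ℕ} {G : SimpleGraph V} (hG : G ∈ regs V k) :
    #(darts G) = k * Fintype.card V := by
  simpa using card_darts_fst hG univ

/-- Switch `xy` away against an oriented edge `pq` outside `F`: at least half of the `kN` oriented
edges will do. Backwards, `p` is a neighbour of `x` and `q` one of `y`, so at most `k ^ 2` choices
remain; the ratio is at most `2k/N`. -/
lemma card_regsWith_insert {k : ℕ} (F : Finset (Sym2 V)) (e : Sym2 V) (he : e ∉ F)
    (h : 4 * #F + 8 * k ^ 2 ≤ k * Fintype.card V) :
    #(regsWith k (insert e F)) * Fintype.card V ≤ 2 * k * #(regsWith k F) := by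
  rcases Nat.eq_zero_or_pos k with rfl | hk
  · have : regsWith 0 (insert e F) = ∅ := by
      refine filter_eq_empty_iff.2 fun G hG hc => ?_
      have he := hc e (mem_insert_self _ _)
      induction e with | _ x y =>
      have h0 := card_eq_zero.1 (mem_regs.1 hG x)
      have : y ∈ nbr G x := by simpa using he
      simp [h0] at this
    simp [this]
  induction e with | _ x y =>
  have key := card_mul_le_card_mul_of_injOn (regsWith k (insert s(x, y) F)) (regsWith k F)
    (fun G => {p ∈ darts G | s(p.1, p.2) ∉ F ∧ Switchable G x y p.1 p.2})
    (fun G => nbr G x ×ˢ nbr G y) (fun p G => switch G x y p.1 p.2)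
    -- Excluded oriented edges: both orientations of `F`; those with `p = x` or `q = y` (`k` each);
    -- those with `p` adjacent to `x` or `q` adjacent to `y` (`k ^ 2` each).
    (l := k * Fintype.card V - 2 * #F - 2 * k - 2 * k ^ 2) (u := k ^ 2) ?_ ?_ ?_ ?_
  · have h2 : k * Fintype.card V ≤ 2 * (k * Fintype.card V - 2 * #F - 2 * k - 2 * k ^ 2) := by
      have : k ≤ k ^ 2 := Nat.le_self_pow two_ne_zero k
      omega
    refine Nat.le_of_mul_le_mul_left (c := k) ?_ hk
    calc k * (#(regsWith k (insert s(x, y) F)) * Fintype.card V)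
        = #(regsWith k (insert s(x, y) F)) * (k * Fintype.card V) := by ring
      _ ≤ #(regsWith k (insert s(x, y) F)) *
          (2 * (k * Fintype.card V - 2 * #F - 2 * k - 2 * k ^ 2)) := Nat.mul_le_mul_left _ h2
      _ ≤ 2 * (#(regsWith k F) * k ^ 2) := by linarith
      _ = k * (2 * k * #(regsWith k F)) := by ring
  · intro G hG p hp
    simp only [regsWith, mem_filter] at hG hp ⊢
    obtain ⟨-, hpF, hs⟩ := hp
    refine ⟨⟨switch_mem_regs hs hG.1, fun f hf => ?_⟩, ?_⟩
    · have hfG := hG.2 f (mem_insert_of_mem hf)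
      induction f with | _ u v =>
      simp only [SimpleGraph.mem_edgeSet] at hfG ⊢
      rw [switch_adj]
      refine Or.inl ⟨hfG, fun e => he (e ▸ hf), fun e => hpF (e ▸ hf)⟩
    · simp only [mem_product, mem_nbr, switch_adj]
      simp [hs.ac, hs.bd]
  · intro G _ G' _ p hp hp' e
    exact switch_injective (mem_filter.1 hp).2.2 (mem_filter.1 hp').2.2 e
  · intro G hG
    simp only [regsWith, mem_filter] at hG
    have hxy : G.Adj x y := by simpa using hG.2 s(x, y) (mem_insert_self _ _)
    have hsub : darts G ⊆ {p ∈ darts G | s(p.1, p.2) ∉ F ∧ Switchable G x y p.1 p.2} ∪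
        ({p ∈ darts G | s(p.1, p.2) ∈ F} ∪ ({p ∈ darts G | p.1 ∈ ({x} : Finset V)} ∪
        ({p ∈ darts G | p.2 ∈ ({y} : Finset V)} ∪ ({p ∈ darts G | p.1 ∈ nbr G x} ∪
        {p ∈ darts G | p.2 ∈ nbr G y})))) := by
      rintro ⟨p, q⟩ hp
      have hpq : G.Adj p q := by simpa [darts] using hp
      simp only [mem_union, mem_filter, hp, true_and, mem_singleton, mem_nbr]
      by_contra hcon
      push Not at hcon
      obtain ⟨h1, h2, h3, h4, h5, h6⟩ := hcon
      exact h1 h2 ⟨hxy, hpq, h5, h6, fun e => h3 e.symm, fun e => h4 e.symm⟩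
    have c1 := card_le_card hsub
    rw [card_darts hG.1] at c1
    have c2 := card_pairs_le F (darts G)
    have c3 := card_darts_fst hG.1 {x}
    have c4 := card_darts_snd hG.1 {y}
    have c5 := card_darts_fst hG.1 (nbr G x)
    have c6 := card_darts_snd hG.1 (nbr G y)
    rw [mem_regs.1 hG.1] at c5 c6
    rw [card_singleton, mul_one] at c3 c4
    rw [← pow_two] at c5 c6
    have := c1.trans (card_union_le _ _)
    have := card_union_le {p ∈ darts G | s(p.1, p.2) ∈ F}
      ({p ∈ darts G | p.1 ∈ ({x} : Finset V)} ∪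
        ({p ∈ darts G | p.2 ∈ ({y} : Finset V)} ∪ ({p ∈ darts G | p.1 ∈ nbr G x} ∪
        {p ∈ darts G | p.2 ∈ nbr G y})))
    have := card_union_le {p ∈ darts G | p.1 ∈ ({x} : Finset V)}
        ({p ∈ darts G | p.2 ∈ ({y} : Finset V)} ∪ ({p ∈ darts G | p.1 ∈ nbr G x} ∪
        {p ∈ darts G | p.2 ∈ nbr G y}))
    have := card_union_le {p ∈ darts G | p.2 ∈ ({y} : Finset V)}
        ({p ∈ darts G | p.1 ∈ nbr G x} ∪ {p ∈ darts G | p.2 ∈ nbr G y})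
    have := card_union_le {p ∈ darts G | p.1 ∈ nbr G x} {p ∈ darts G | p.2 ∈ nbr G y}
    omega
  · intro G hG
    have := mem_regs.1 (mem_filter.1 hG).1
    rw [card_product, this, this, pow_two]

/-- A given set of `f` edges is present in a fraction at most `(2k/N)^f` of the regular graphs. -/
lemma card_regsWith_le {k : ℕ} (F : Finset (Sym2 V))
    (h : 4 * #F + 8 * k ^ 2 ≤ k * Fintype.card V) :
    #(regsWith k F) * Fintype.card V ^ #F ≤ (2 * k) ^ #F * #(regs V k) := by
  induction F using Finset.induction_on with
  | empty => simp [regsWith]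
  | insert e F he ih =>
    rw [card_insert_of_notMem he] at h ⊢
    have h1 := card_regsWith_insert F e he (k := k) (by omega)
    have h2 := ih (by omega)
    calc #(regsWith k (insert e F)) * Fintype.card V ^ (#F + 1)
        = (#(regsWith k (insert e F)) * Fintype.card V) * Fintype.card V ^ #F := by ring
      _ ≤ (2 * k * #(regsWith k F)) * Fintype.card V ^ #F := Nat.mul_le_mul_right _ h1
      _ = 2 * k * (#(regsWith k F) * Fintype.card V ^ #F) := by ring
      _ ≤ 2 * k * ((2 * k) ^ #F * #(regs V k)) := Nat.mul_le_mul_left _ h2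
      _ = _ := by ring

end Containment

/-! ### Joining two large balls by switchings -/

section Ball

variable {V : Type*} [Fintype V]

/-- The ball of radius `n` around `x`. -/
def ball (G : SimpleGraph V) (x : V) : ℕ → Finset V
  | 0 => {x}
  | n + 1 => ball G x n ∪ (ball G x n).biUnion (nbr G)

lemma mem_ball_succ {G : SimpleGraph V} {x v : V} {n : ℕ} :
    v ∈ ball G x (n + 1) ↔ v ∈ ball G x n ∨ ∃ u ∈ ball G x n, G.Adj u v := by
  simp [ball]

lemma ball_mono {G : SimpleGraph V} {x : V} {m n : ℕ} (h : m ≤ n) : ball G x m ⊆ ball G x n := by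
  induction n, h using Nat.le_induction with
  | base => rfl
  | succ n _ ih => exact ih.trans subset_union_left

lemma mem_ball_iff {G : SimpleGraph V} {x v : V} {n : ℕ} :
    v ∈ ball G x n ↔ ∃ p : G.Walk x v, p.length ≤ n := by
  constructor
  · intro h
    induction n generalizing v with
    | zero =>
      obtain rfl : v = x := by simpa [ball] using h
      exact ⟨.nil, le_rfl⟩
    | succ n ih =>
      rcases mem_ball_succ.1 h with h | ⟨u, h, a⟩
      · obtain ⟨p, hp⟩ := ih h
        exact ⟨p, by omega⟩
      · obtain ⟨p, hp⟩ := ih h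
        exact ⟨p.concat a, by simpa using hp⟩
  · rintro ⟨p, hp⟩
    induction n generalizing v with
    | zero =>
      have := SimpleGraph.Walk.eq_of_length_eq_zero (p := p) (by omega)
      simp [ball, this]
    | succ n ih =>
      rw [mem_ball_succ]
      by_cases h : p.length ≤ n
      · exact Or.inl (ih p h)
      · have h0 : ¬ p.Nil := fun h0 => by
          have := SimpleGraph.Walk.length_eq_zero_iff.2 h0
          omega
        refine Or.inr ⟨_, ih p.dropLast ?_, p.adj_penultimate h0⟩
        simp only [SimpleGraph.Walk.dropLast]
        rw [SimpleGraph.Walk.take_length]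
        omega

lemma ball_congr {G G' : SimpleGraph V} {x : V} (r : ℕ)
    (h : ∀ j < r, ∀ z ∈ ball G x j, ∀ v, G'.Adj z v ↔ G.Adj z v) : ball G' x r = ball G x r := by
  induction r with
  | zero => rfl
  | succ r ih =>
    have e := ih fun j hj => h j (by omega)
    ext v
    rw [mem_ball_succ, mem_ball_succ, e]
    refine or_congr Iff.rfl (exists_congr fun u => and_congr_right fun hu => ?_)
    exact h r (by omega) u hu v

/-- The ordered adjacent pairs from `A` to `B`. -/
def between (G : SimpleGraph V) (A B : Finset V) : Finset (V × V) :=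
  {p ∈ darts G | p.1 ∈ A ∧ p.2 ∈ B}

lemma mem_between {G : SimpleGraph V} {A B : Finset V} {u v : V} :
    (u, v) ∈ between G A B ↔ G.Adj u v ∧ u ∈ A ∧ v ∈ B := by
  simp [between, darts]

lemma card_between_comm (G : SimpleGraph V) (A B : Finset V) :
    #(between G A B) = #(between G B A) := by
  refine card_bij' (fun p _ => p.swap) (fun p _ => p.swap) ?_ ?_ ?_ ?_ <;>
    simp +contextual [between, darts, SimpleGraph.adj_comm]

lemma disjoint_ball_of_notMem {G : SimpleGraph V} {x y : V} {r : ℕ}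
    (h : y ∉ ball G x (2 * r + 1)) :
    Disjoint (ball G x r) (ball G y r) ∧ between G (ball G x r) (ball G y r) = ∅ := by
  simp only [mem_ball_iff, not_exists] at h
  constructor
  · rw [disjoint_left]
    intro z hx hy
    obtain ⟨p, hp⟩ := mem_ball_iff.1 hx
    obtain ⟨q, hq⟩ := mem_ball_iff.1 hy
    refine h (p.append q.reverse) ?_
    simp only [SimpleGraph.Walk.length_append, SimpleGraph.Walk.length_reverse]
    omega
  · rw [eq_empty_iff_forall_notMem]
    rintro ⟨u, w⟩ hp
    obtain ⟨a, hx, hy⟩ := mem_between.1 hp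
    obtain ⟨p, hp⟩ := mem_ball_iff.1 hx
    obtain ⟨q, hq⟩ := mem_ball_iff.1 hy
    refine h ((p.concat a).append q.reverse) ?_
    simp only [SimpleGraph.Walk.length_append, SimpleGraph.Walk.length_reverse,
      SimpleGraph.Walk.length_concat]
    omega

/-- The regular graphs for which the `r`-balls around `x` and `y` are disjoint, each is left by at
least `m` edges, and exactly `j` edges join the two balls. -/
def farClass (k m r : ℕ) (x y : V) (j : ℕ) : Finset (SimpleGraph V) :=
  {G ∈ regs V k | Disjoint (ball G x r) (ball G y r) ∧
    #(between G (ball G x r) (ball G x r)) + m ≤ k * #(ball G x r) ∧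
    #(between G (ball G y r) (ball G y r)) + m ≤ k * #(ball G y r) ∧
    #(between G (ball G x r) (ball G y r)) = j}

/-- The ordered edges that leave `A` and do not end in `A ∪ B`. -/
def leaving (G : SimpleGraph V) (A B : Finset V) : Finset (V × V) :=
  {p ∈ darts G | p.1 ∈ A ∧ p.2 ∉ A ∧ p.2 ∉ B}

lemma mem_leaving {G : SimpleGraph V} {A B : Finset V} {p : V × V} :
    p ∈ leaving G A B ↔ G.Adj p.1 p.2 ∧ p.1 ∈ A ∧ p.2 ∉ A ∧ p.2 ∉ B := by
  simp [leaving, darts]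

lemma le_card_leaving {k m : ℕ} {G : SimpleGraph V} (hG : G ∈ regs V k) {A B : Finset V}
    (h : #(between G A A) + m ≤ k * #A) : m ≤ #(leaving G A B) + #(between G A B) := by
  have hsub : {p ∈ darts G | p.1 ∈ A} ⊆ between G A A ∪ (leaving G A B ∪ between G A B) := by
    intro p
    simp only [between, leaving, mem_union, mem_filter]
    tauto
  have h1 := card_le_card hsub
  rw [card_darts_fst hG] at h1
  have h2 := card_union_le (between G A A) (leaving G A B ∪ between G A B)
  have h3 := card_union_le (leaving G A B) (between G A B)
  omega

lemma ball_switch_left {G : SimpleGraph V} {x : V} {r : ℕ} {a b c d : V}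
    (hab : G.Adj a b) (hb : b ∉ ball G x r) (hc : c ∉ ball G x r) (hd : d ∉ ball G x r) :
    ball (switch G a b c d) x r = ball G x r := by
  refine ball_congr r fun j hj z hz v => switch_adj_of_ne ?_ ?_ ?_ ?_ v
  -- The end `a` may lie in the `r`-ball, but only at distance exactly `r`, because its neighbour
  -- `b` is outside; adjacency at distance `r` does not affect the ball.
  · rintro rfl
    exact hb (ball_mono (Nat.succ_le_of_lt hj) (mem_ball_succ.2 (Or.inr ⟨_, hz, hab⟩)))
  · rintro rfl; exact hb (ball_mono hj.le hz)
  · rintro rfl; exact hc (ball_mono hj.le hz)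
  · rintro rfl; exact hd (ball_mono hj.le hz)

lemma between_switch_self {G : SimpleGraph V} {A : Finset V} {a b c d : V}
    (hb : b ∉ A) (hc : c ∉ A) (hd : d ∉ A) :
    between (switch G a b c d) A A = between G A A := by
  ext ⟨u, v⟩
  simp only [mem_between, switch_adj, Sym2.eq_iff]
  grind

lemma between_switch {G : SimpleGraph V} {A B : Finset V} {a b c d : V} (hAB : Disjoint A B)
    (ha : a ∈ A) (hc : c ∈ B) (hb : b ∉ A) (hb' : b ∉ B) (hd : d ∉ A) (hd' : d ∉ B) :
    between (switch G a b c d) A B = insert (a, c) (between G A B) := by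
  have hne : a ≠ c := fun e => disjoint_left.1 hAB ha (e ▸ hc)
  have := disjoint_left.1 hAB ha
  have := disjoint_right.1 hAB hc
  ext ⟨u, v⟩
  simp only [mem_between, mem_insert, switch_adj, Sym2.eq_iff, Prod.mk.injEq]
  grind

lemma switch_mem_farClass {k m r j : ℕ} {x y : V} {G : SimpleGraph V} {a b c d : V}
    (hG : G ∈ farClass k m r x y j) (hs : Switchable G a b c d)
    (ha : a ∈ ball G x r) (hc : c ∈ ball G y r) (hb : b ∉ ball G x r) (hb' : b ∉ ball G y r)
    (hd : d ∉ ball G x r) (hd' : d ∉ ball G y r) :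
    switch G a b c d ∈ farClass k m r x y (j + 1) ∧
      ball (switch G a b c d) x r = ball G x r ∧ ball (switch G a b c d) y r = ball G y r := by
  simp only [farClass, mem_filter] at hG ⊢
  obtain ⟨hreg, hdis, hx, hy, hj⟩ := hG
  have ha' := disjoint_left.1 hdis ha
  have hc' := disjoint_right.1 hdis hc
  have ex : ball (switch G a b c d) x r = ball G x r := ball_switch_left hs.ab hb hc' hd
  have ey : ball (switch G a b c d) y r = ball G y r := by
    rw [switch_flip]; exact ball_switch_left hs.cd hd' ha' hb'
  refine ⟨⟨switch_mem_regs hs hreg, ?_⟩, ex, ey⟩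
  rw [ex, ey, between_switch hdis ha hc hb hb' hd hd', between_switch_self hb hc' hd,
    switch_flip, between_switch_self hd' ha' hb', card_insert_of_notMem, hj]
  · exact ⟨hdis, hx, hy, rfl⟩
  · simp [mem_between, hs.nac]

/-- The bad edges `cd` have `c` adjacent to `a` or `d` adjacent to `b` (`k ^ 2` each), or `d = b`
(`k ≤ k ^ 2`). -/
lemma card_switchable_ge {k m : ℕ} {G : SimpleGraph V} (hG : G ∈ regs V k) {a b : V}
    (hab : G.Adj a b) {S : Finset (V × V)} (hS : S ⊆ darts G) (ha : ∀ p ∈ S, a ≠ p.1)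
    (hm : m ≤ #S) : m - 3 * k ^ 2 ≤ #{q ∈ S | Switchable G a b q.1 q.2} := by
  have hsub : S ⊆ {q ∈ S | Switchable G a b q.1 q.2} ∪ ({p ∈ darts G | p.1 ∈ nbr G a} ∪
      ({p ∈ darts G | p.2 ∈ nbr G b} ∪ {p ∈ darts G | p.2 ∈ ({b} : Finset V)})) := by
    intro q hq
    have hqd := hS hq
    have hqa : G.Adj q.1 q.2 := by simpa [darts] using hqd
    simp only [mem_union, mem_filter, hq, hqd, true_and, mem_nbr, mem_singleton]
    by_contra hcon
    push Not at hcon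
    exact hcon.1 ⟨hab, hqa, hcon.2.1, hcon.2.2.1, ha q hq, hcon.2.2.2.symm⟩
  have h1 := card_le_card hsub
  have h2 := card_union_le {q ∈ S | Switchable G a b q.1 q.2} ({p ∈ darts G | p.1 ∈ nbr G a} ∪
      ({p ∈ darts G | p.2 ∈ nbr G b} ∪ {p ∈ darts G | p.2 ∈ ({b} : Finset V)}))
  have h3 := card_union_le {p ∈ darts G | p.1 ∈ nbr G a}
      ({p ∈ darts G | p.2 ∈ nbr G b} ∪ {p ∈ darts G | p.2 ∈ ({b} : Finset V)})
  have h4 := card_union_le {p ∈ darts G | p.2 ∈ nbr G b} {p ∈ darts G | p.2 ∈ ({b} : Finset V)}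
  have c1 := card_darts_fst hG (nbr G a)
  have c2 := card_darts_snd hG (nbr G b)
  have c3 := card_darts_snd hG {b}
  rw [mem_regs.1 hG, ← pow_two] at c1 c2
  rw [card_singleton, mul_one] at c3
  have : k ≤ k ^ 2 := Nat.le_self_pow two_ne_zero k
  omega

/-- Switching an edge `ab` that leaves the first ball with an edge `cd` that leaves the second keeps
both balls and adds exactly the joining edge `ac`. At most `j` of the `m` outgoing edges of each
ball already join them. Backwards, `ac` is one of `j + 1` joining edges and `bd` any oriented edge.
-/
lemma card_farClass_mul_le (k m r : ℕ) (x y : V) (j : ℕ) :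
    #(farClass k m r x y j) * ((m - j) * (m - j - 3 * k ^ 2)) ≤
      #(farClass k m r x y (j + 1)) * ((j + 1) * (k * Fintype.card V)) := by
  refine card_mul_le_card_mul_of_injOn (farClass k m r x y j) (farClass k m r x y (j + 1))
    (fun G => (leaving G (ball G x r) (ball G y r)).sigma fun p =>
      {q ∈ leaving G (ball G y r) (ball G x r) | Switchable G p.1 p.2 q.1 q.2})
    -- The data `((a, c), (b, d))` is regrouped as `⟨(a, b), (c, d)⟩`.
    (fun G => ((between G (ball G x r) (ball G y r)) ×ˢ darts G).map
      ((Equiv.prodProdProdComm V V V V).trans (Equiv.sigmaEquivProd _ _).symm).toEmbedding)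
    (fun p G => switch G p.1.1 p.1.2 p.2.1 p.2.2) ?_ ?_ ?_ ?_
  · rintro G hG ⟨⟨a, b⟩, ⟨c, d⟩⟩ hp
    simp only [mem_sigma, mem_filter, mem_leaving] at hp
    obtain ⟨⟨-, ha, hb, hb'⟩, ⟨-, hc, hd', hd⟩, hs⟩ := hp
    obtain ⟨h1, h2, h3⟩ := switch_mem_farClass hG hs ha hc hb hb' hd hd'
    refine ⟨h1, ?_⟩
    rw [mem_map_equiv]
    simp [mem_product, mem_between, h2, h3, darts, switch_adj, ha, hc, hs.ac, hs.bd]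
  · rintro G - G' - p hp hp' e
    exact switch_injective (mem_filter.1 (mem_sigma.1 hp).2).2
      (mem_filter.1 (mem_sigma.1 hp').2).2 e
  · intro G hG
    simp only [farClass, mem_filter] at hG
    obtain ⟨hreg, hdis, hx, hy, hj⟩ := hG
    have l1 := le_card_leaving (B := ball G y r) hreg hx
    have l2 := le_card_leaving (B := ball G x r) hreg hy
    rw [card_between_comm] at l2
    rw [card_sigma]
    calc (m - j) * (m - j - 3 * k ^ 2)
        ≤ #(leaving G (ball G x r) (ball G y r)) * (m - j - 3 * k ^ 2) :=
          Nat.mul_le_mul_right _ (by omega)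
      _ ≤ _ := by
        rw [← smul_eq_mul]
        refine card_nsmul_le_sum _ _ _ fun p hp => ?_
        rw [mem_leaving] at hp
        refine card_switchable_ge hreg hp.1 (filter_subset _ _) ?_ (by omega)
        rintro q hq e
        exact disjoint_left.1 hdis hp.2.1 (e ▸ (mem_leaving.1 hq).2.1)
  · intro G hG
    simp only [farClass, mem_filter] at hG
    rw [card_map, card_product, card_darts hG.1, hG.2.2.2.2]

/-- Iterate the previous comparison `J` times. Starting from `2 * m` outgoing edges, both factors
stay at least `m` throughout. -/
lemma card_farClass_zero_le (k m r J : ℕ) (x y : V) (h : J + 3 * k ^ 2 ≤ m) :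
    #(farClass k (2 * m) r x y 0) * (m ^ 2) ^ J ≤ #(regs V k) * (J * (k * Fintype.card V)) ^ J := by
  have key : ∀ i ≤ J, #(farClass k (2 * m) r x y 0) * (m ^ 2) ^ i ≤
      #(farClass k (2 * m) r x y i) * (J * (k * Fintype.card V)) ^ i := by
    intro i hi
    induction i with
    | zero => simp
    | succ i ih =>
      have h1 := card_farClass_mul_le k (2 * m) r x y i
      have h2 : m ^ 2 ≤ (2 * m - i) * (2 * m - i - 3 * k ^ 2) := by
        rw [pow_two]; exact Nat.mul_le_mul (by omega) (by omega)
      calc #(farClass k (2 * m) r x y 0) * (m ^ 2) ^ (i + 1)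
          = #(farClass k (2 * m) r x y 0) * (m ^ 2) ^ i * m ^ 2 := by ring
        _ ≤ #(farClass k (2 * m) r x y i) * (J * (k * Fintype.card V)) ^ i * m ^ 2 :=
          Nat.mul_le_mul_right _ (ih (by omega))
        _ = #(farClass k (2 * m) r x y i) * m ^ 2 * (J * (k * Fintype.card V)) ^ i := by ring
        _ ≤ #(farClass k (2 * m) r x y i) * ((2 * m - i) * (2 * m - i - 3 * k ^ 2)) *
            (J * (k * Fintype.card V)) ^ i := by gcongr
        _ ≤ #(farClass k (2 * m) r x y (i + 1)) * ((i + 1) * (k * Fintype.card V)) *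
            (J * (k * Fintype.card V)) ^ i := Nat.mul_le_mul_right _ h1
        _ ≤ #(farClass k (2 * m) r x y (i + 1)) * (J * (k * Fintype.card V)) *
            (J * (k * Fintype.card V)) ^ i := by gcongr
        _ = _ := by ring
  exact (key J le_rfl).trans (Nat.mul_le_mul_right _ (card_le_card (filter_subset _ _)))

end Ball

/-! ### Upper and lower bounds for the growth of balls -/

section Growth

variable {V : Type*} [Fintype V]

/-- The sphere of radius `n` around `x`. -/
def sphere (G : SimpleGraph V) (x : V) : ℕ → Finset V
  | 0 => {x}
  | n + 1 => ball G x (n + 1) \ ball G x n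

lemma exists_mem_sphere {G : SimpleGraph V} {x v : V} {n : ℕ} (h : v ∈ ball G x n) :
    ∃ a ≤ n, v ∈ sphere G x a := by
  induction n with
  | zero => exact ⟨0, le_rfl, h⟩
  | succ n ih =>
    by_cases h' : v ∈ ball G x n
    · obtain ⟨a, ha, hv⟩ := ih h'
      exact ⟨a, by omega, hv⟩
    · exact ⟨n + 1, le_rfl, mem_sdiff.2 ⟨h, h'⟩⟩

/-- Away from the centre, each vertex has a neighbour one step back, hence at most `k - 1` forward.
The factor `2` covers the first step, where `k ≤ 2 * (k - 1)`. -/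
lemma card_sphere_le {k : ℕ} (hk : 3 ≤ k) {G : SimpleGraph V} (hG : G ∈ regs V k) (x : V) (n : ℕ) :
    #(sphere G x n) ≤ 2 * (k - 1) ^ n := by
  induction n with
  | zero => simp [sphere]
  | succ n ih =>
    cases n with
    | zero =>
      have hsub : sphere G x (0 + 1) ⊆ nbr G x := by
        intro v hv
        simp only [sphere, zero_add, mem_sdiff, mem_ball_succ (n := 0)] at hv
        simp only [ball, mem_singleton, exists_eq_left] at hv
        simpa using hv.1.resolve_left hv.2
      have := card_le_card hsub
      rw [mem_regs.1 hG] at this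
      rw [pow_add, pow_zero, pow_one, one_mul]
      omega
    | succ n =>
      have hsub : sphere G x (n + 1 + 1) ⊆
          (sphere G x (n + 1)).biUnion fun u => nbr G u \ ball G x n := by
        intro v hv
        rw [sphere, mem_sdiff, mem_ball_succ (n := n + 1)] at hv
        obtain ⟨u, hu, a⟩ := hv.1.resolve_left hv.2
        refine mem_biUnion.2 ⟨u, mem_sdiff.2 ⟨hu, fun h => hv.2 ?_⟩, mem_sdiff.2 ⟨by simpa, ?_⟩⟩
        · exact mem_ball_succ.2 (Or.inr ⟨u, h, a⟩)
        · exact fun h => hv.2 (ball_mono (Nat.le_succ n) h)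
      calc #(sphere G x (n + 1 + 1)) ≤ _ := card_le_card hsub
        _ ≤ #(sphere G x (n + 1)) * (k - 1) := by
          refine card_biUnion_le_card_mul _ _ _ fun u hu => ?_
          obtain ⟨hu1, hu2⟩ := mem_sdiff.1 hu
          obtain ⟨w, hw, a⟩ := (mem_ball_succ.1 hu1).resolve_left hu2
          have hlt : #(nbr G u \ ball G x n) < #(nbr G u) := by
            refine card_lt_card ⟨sdiff_subset, fun h => ?_⟩
            exact (mem_sdiff.1 (h (mem_nbr.2 a.symm))).2 hw
          rw [mem_regs.1 hG] at hlt
          omega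
        _ ≤ 2 * (k - 1) ^ (n + 1) * (k - 1) := Nat.mul_le_mul_right _ ih
        _ = _ := by ring

lemma card_ball_le {k : ℕ} (hk : 3 ≤ k) {G : SimpleGraph V} (hG : G ∈ regs V k) (x : V) (n : ℕ) :
    #(ball G x n) ≤ 4 * (k - 1) ^ n := by
  induction n with
  | zero => simp [ball]
  | succ n ih =>
    have h1 := card_sphere_le hk hG x (n + 1)
    have h2 := card_sdiff_add_card_eq_card (ball_mono (G := G) (x := x) (Nat.le_succ n))
    have h3 : 2 * (k - 1) ^ n ≤ (k - 1) ^ (n + 1) := by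
      rw [pow_succ, mul_comm]; exact Nat.mul_le_mul_left _ (by omega)
    simp only [sphere, Nat.succ_eq_add_one] at h1 h2
    omega

/-- Every set of at most `M` vertices spans at most `1 + ε` edges per vertex. -/
def IsSparse (G : SimpleGraph V) (M ε : ℝ) : Prop :=
  ∀ S : Finset V, (#S : ℝ) ≤ M → (#(between G S S) : ℝ) ≤ 2 * (1 + ε) * #S

/-- Inclusion–exclusion for the oriented edges starting, respectively ending, in the `n`-ball: the
union lies inside the next ball, the intersection inside this one. -/
lemma two_mul_card_ball_le {k : ℕ} {G : SimpleGraph V} (hG : G ∈ regs V k) (x : V) (n : ℕ) :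
    2 * (k * #(ball G x n)) ≤ #(between G (ball G x (n + 1)) (ball G x (n + 1))) +
      #(between G (ball G x n) (ball G x n)) := by
  have h := card_union_add_card_inter {p ∈ darts G | p.1 ∈ ball G x n}
    {p ∈ darts G | p.2 ∈ ball G x n}
  rw [card_darts_fst hG, card_darts_snd hG] at h
  have h1 : {p ∈ darts G | p.1 ∈ ball G x n} ∩ {p ∈ darts G | p.2 ∈ ball G x n} =
      between G (ball G x n) (ball G x n) := by
    ext p; simp only [between, mem_inter, mem_filter]; tauto
  have h2 : {p ∈ darts G | p.1 ∈ ball G x n} ∪ {p ∈ darts G | p.2 ∈ ball G x n} ⊆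
      between G (ball G x (n + 1)) (ball G x (n + 1)) := by
    rintro ⟨u, v⟩ hp
    simp only [mem_union, mem_filter, darts, mem_univ, true_and] at hp
    rw [mem_between]
    rcases hp with ⟨a, hu⟩ | ⟨a, hv⟩
    · exact ⟨a, ball_mono (Nat.le_succ n) hu, mem_ball_succ.2 (Or.inr ⟨u, hu, a⟩)⟩
    · exact ⟨a, mem_ball_succ.2 (Or.inr ⟨v, hv, a.symm⟩), ball_mono (Nat.le_succ n) hv⟩
  have h3 := card_le_card h2
  rw [h1] at h
  omega

lemma IsSparse.pow_le_card_ball {k : ℕ} {G : SimpleGraph V} (hG : G ∈ regs V k) {M ε : ℝ}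
    (hs : IsSparse G M ε) (hε : 0 ≤ ε) (hε' : ε ≤ 1) (hkε : k * ε ≤ k - 1) (x : V) (n : ℕ)
    (hM : (#(ball G x n) : ℝ) ≤ M) : ((k : ℝ) - 1 - k * ε) ^ n ≤ #(ball G x n) := by
  induction n with
  | zero => simp [ball]
  | succ n ih =>
    have hle : (#(ball G x n) : ℝ) ≤ #(ball G x (n + 1)) :=
      Nat.cast_le.2 (card_le_card (ball_mono (Nat.le_succ n)))
    have ih := ih (hle.trans hM)
    have h1 := hs _ hM
    have h2 := hs _ (hle.trans hM)
    have h3 : (2 : ℝ) * (k * #(ball G x n)) ≤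
        #(between G (ball G x (n + 1)) (ball G x (n + 1))) +
          #(between G (ball G x n) (ball G x n)) := by
      exact_mod_cast two_mul_card_ball_le hG x n
    generalize (#(ball G x n) : ℝ) = b at *
    generalize (#(ball G x (n + 1)) : ℝ) = b' at *
    have hb : 0 ≤ b := le_trans (pow_nonneg (by linarith) n) ih
    have h4 : (k : ℝ) * b ≤ (1 + ε) * (b + b') := by linarith
    -- Multiplying `h4` by `1 - ε` turns its right side into `(1 - ε²)(b + b') ≤ b + b'`.
    have h5 : (k - 1 - k * ε) * b ≤ b' := by
      have h6 := mul_le_mul_of_nonneg_left h4 (sub_nonneg.2 hε')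
      nlinarith [mul_nonneg (mul_nonneg hε hε) (add_nonneg hb (hb.trans hle))]
    calc ((k : ℝ) - 1 - k * ε) ^ (n + 1) = (k - 1 - k * ε) * (k - 1 - k * ε) ^ n := by ring
      _ ≤ (k - 1 - k * ε) * b := mul_le_mul_of_nonneg_left ih (by linarith)
      _ ≤ b' := h5

/-- In a sparse graph, a ball containing many vertices is left by many edges. -/
lemma IsSparse.card_between_add_le {k : ℕ} (hk : 3 ≤ k) {G : SimpleGraph V} {M ε : ℝ}
    (hs : IsSparse G M ε) (hε : ε ≤ 1 / 4) {S : Finset V} (hM : (#S : ℝ) ≤ M) {m : ℕ}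
    (hm : 2 * m ≤ #S) : #(between G S S) + m ≤ k * #S := by
  have h1 := hs S hM
  have h2 : (2 : ℝ) * m ≤ #S := by exact_mod_cast hm
  have h3 : (3 : ℝ) ≤ k := by exact_mod_cast hk
  have : (#(between G S S) : ℝ) + m ≤ k * #S := by
    have := mul_le_mul_of_nonneg_right hε (Nat.cast_nonneg' (α := ℝ) #S)
    have := mul_le_mul_of_nonneg_right h3 (Nat.cast_nonneg' (α := ℝ) #S)
    linarith
  exact_mod_cast this

end Growth

/-! ### From diameter to vertex flow -/

section Flow

variable {V : Type*} [Fintype V]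

lemma mass_nonneg (G : SimpleGraph V) (s t : V) (n : ℕ) (v : V) : 0 ≤ mass G s t n v := by
  induction n generalizing v with
  | zero => simp only [mass]; split_ifs <;> norm_num
  | succ n ih =>
    refine sum_nonneg fun u _ => ?_
    split_ifs
    · exact div_nonneg (ih u) (Nat.cast_nonneg _)
    · exact le_rfl

lemma sum_mass_le_one (G : SimpleGraph V) (s t : V) (n : ℕ) : ∑ v, mass G s t n v ≤ 1 := by
  induction n with
  | zero => simp [mass]
  | succ n ih =>
    simp only [mass]
    rw [sum_comm]
    refine le_trans (sum_le_sum fun u _ => ?_) ih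
    rw [← sum_filter, sum_const, filter_mem_eq_inter, univ_inter, nsmul_eq_mul]
    rcases Nat.eq_zero_or_pos #(nextHops G t u) with h | h
    · simp [h, mass_nonneg]
    · rw [mul_div_cancel₀]
      exact_mod_cast h.ne'

lemma mass_le_one (G : SimpleGraph V) (s t : V) (n : ℕ) (v : V) : mass G s t n v ≤ 1 :=
  (single_le_sum (fun u _ => mass_nonneg G s t n u) (mem_univ v)).trans (sum_mass_le_one G s t n)

/-- Every hop lowers the distance to `t` by one, so the hop at which flow can be at `v` is
determined by `v`. Hence a pair contributes at most one unit at `v`. -/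
lemma mass_support {G : SimpleGraph V} {s t v : V} {n : ℕ} (h : mass G s t n v ≠ 0) :
    G.dist v t + n = G.dist s t ∧ v ∈ ball G s n := by
  induction n generalizing v with
  | zero =>
    have : v = s := by
      by_contra hv
      simp [mass, hv] at h
    simp [this, ball]
  | succ n ih =>
    obtain ⟨u, -, hu⟩ := exists_ne_zero_of_sum_ne_zero h
    split_ifs at hu with hv
    · have hu' : mass G s t n u ≠ 0 := fun e => hu (by simp [e])
      obtain ⟨h1, h2⟩ := ih hu'
      simp only [nextHops, mem_filter, mem_univ, true_and] at hv
      exact ⟨by omega, mem_ball_succ.2 (Or.inr ⟨u, h2, hv.1⟩)⟩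
    · exact absurd rfl hu

lemma pairFlow_le_one (G : SimpleGraph V) (s t v : V) : pairFlow G s t v ≤ 1 := by
  unfold pairFlow
  split_ifs
  · by_cases h : ∃ n ∈ range (G.dist s t + 1), mass G s t n v ≠ 0
    · obtain ⟨n, hn, h⟩ := h
      rw [sum_eq_single_of_mem n hn]
      · exact mass_le_one G s t n v
      · intro m _ hmn
        by_contra hm
        have := (mass_support h).1
        have := (mass_support hm).1
        omega
    · push Not at h
      rw [sum_eq_zero h]
      exact zero_le_one
  · exact zero_le_one

lemma mem_ball_comm {G : SimpleGraph V} {u v : V} {n : ℕ} : u ∈ ball G v n ↔ v ∈ ball G u n := by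
  simp only [mem_ball_iff]
  constructor <;> rintro ⟨p, hp⟩ <;> exact ⟨p.reverse, by simpa using hp⟩

lemma mem_ball_dist {G : SimpleGraph V} {u v : V} (h : G.Reachable u v) :
    v ∈ ball G u (G.dist u v) := by
  obtain ⟨p, hp⟩ := h.exists_walk_length_eq_dist
  exact mem_ball_iff.2 ⟨p, hp.le⟩

lemma dist_le_of_mem_ball {G : SimpleGraph V} {u v : V} {n : ℕ} (h : v ∈ ball G u n) :
    G.dist u v ≤ n := by
  obtain ⟨p, hp⟩ := mem_ball_iff.1 h
  exact (SimpleGraph.dist_le p).trans hp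

lemma pairFlow_support {G : SimpleGraph V} {s t v : V} (h : pairFlow G s t v ≠ 0) :
    ∃ a ≤ G.dist s t, s ∈ sphere G v a ∧ t ∈ ball G v (G.dist s t - a) := by
  unfold pairFlow at h
  split_ifs at h with hr
  · obtain ⟨n, -, hm⟩ := exists_ne_zero_of_sum_ne_zero h
    obtain ⟨h1, h2⟩ := mass_support hm
    obtain ⟨p, -⟩ := mem_ball_iff.1 h2
    have hvt : G.Reachable v t := p.reachable.symm.trans hr
    obtain ⟨a, ha, hs⟩ := exists_mem_sphere (mem_ball_comm.1 h2)
    exact ⟨a, by omega, hs, ball_mono (by omega) (mem_ball_dist hvt)⟩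
  · exact absurd rfl h

/-- The flow through a vertex of a regular graph of diameter at most `D`. -/
lemma vertexFlow_le {k : ℕ} (hk : 3 ≤ k) {G : SimpleGraph V} (hG : G ∈ regs V k) {D : ℕ}
    (hD : ∀ x y, y ∈ ball G x D) (r : V → V → Prop) (v : V) :
    vertexFlow G r v ≤ 8 * (D + 1) * ((k : ℝ) - 1) ^ D := by
  -- All ordered pairs that can route through `v`, sorted by the distance `a` from `v` to the
  -- source.
  set P : Finset (V × V) := (range (D + 1)).biUnion fun a => sphere G v a ×ˢ ball G v (D - a)
    with hP
  have h1 : vertexFlow G r v ≤ #P := by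
    unfold vertexFlow
    rw [← sum_product' (s := univ) (t := univ)
      (f := fun s t => if r s t then pairFlow G s t v else 0), ← nsmul_one, ← sum_const]
    have : ∑ _x ∈ P, (1 : ℝ) = ∑ x : V × V, if x ∈ P then 1 else 0 := by simp
    rw [this, univ_product_univ]
    refine sum_le_sum fun p _ => ?_
    by_cases hp : p ∈ P
    · rw [if_pos hp]
      split_ifs
      · exact pairFlow_le_one G _ _ v
      · exact zero_le_one
    · rw [if_neg hp]
      split_ifs
      · refine le_of_eq (by_contra fun h => hp ?_)
        obtain ⟨a, ha, hs, ht⟩ := pairFlow_support h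
        have hd := dist_le_of_mem_ball (hD p.1 p.2)
        refine mem_biUnion.2 ⟨a, mem_range.2 (by omega), mem_product.2 ⟨hs, ?_⟩⟩
        exact ball_mono (by omega) ht
      · exact le_rfl
  have h2 : #P ≤ (D + 1) * (8 * (k - 1) ^ D) := by
    refine (card_biUnion_le_card_mul _ _ (8 * (k - 1) ^ D) fun a ha => ?_).trans (by simp)
    rw [card_product]
    have e : (k - 1) ^ D = (k - 1) ^ a * (k - 1) ^ (D - a) := by
      rw [← pow_add]; congr 1; have := mem_range.1 ha; omega
    calc #(sphere G v a) * #(ball G v (D - a))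
        ≤ (2 * (k - 1) ^ a) * (4 * (k - 1) ^ (D - a)) :=
          Nat.mul_le_mul (card_sphere_le hk hG v a) (card_ball_le hk hG v _)
      _ = 8 * (k - 1) ^ D := by rw [e]; ring
  calc vertexFlow G r v ≤ #P := h1
    _ ≤ (((D + 1) * (8 * (k - 1) ^ D) : ℕ) : ℝ) := by exact_mod_cast h2
    _ = _ := by push_cast [Nat.cast_sub (show 1 ≤ k by omega)]; ring

end Flow

/-! ### Existence of regular graphs, so that the probability is not `0 / 0` -/

section Existence

/-- Add pairs `{x, -x}` one at a time; having at most two solutions of `x + x = 0` leaves room for a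
fresh `x ≠ -x`. -/
lemma exists_symmetric_finset {A : Type*} [AddCommGroup A] [Fintype A] {S₀ : Finset A}
    (hneg : ∀ x ∈ S₀, -x ∈ S₀) (h0 : 0 ∉ S₀) (h2 : #(univ.filter fun x : A => x + x = 0) ≤ 2) (m : ℕ)
    (hm : #S₀ + 2 * m < Fintype.card A) :
    ∃ S : Finset A, (∀ x ∈ S, -x ∈ S) ∧ 0 ∉ S ∧ #S = #S₀ + 2 * m := by
  induction m with
  | zero => exact ⟨S₀, hneg, h0, rfl⟩
  | succ m ih =>
    obtain ⟨S, hS, hS0, hc⟩ := ih (by omega)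
    have hlt : #(S ∪ (univ.filter fun x : A => x + x = 0)) < #(univ : Finset A) := by
      have := card_union_le S (univ.filter fun x : A => x + x = 0)
      rw [card_univ]
      omega
    obtain ⟨x, -, hx⟩ := exists_mem_notMem_of_card_lt_card hlt
    simp only [mem_union, mem_filter, mem_univ, true_and, not_or] at hx
    have hxn : x ≠ -x := fun e => hx.2 (by nth_rewrite 2 [e]; simp)
    have hxS : -x ∉ S := fun h => hx.1 (by simpa using hS _ h)
    refine ⟨insert x (insert (-x) S), ?_, ?_, ?_⟩
    · intro y hy
      simp only [mem_insert] at hy ⊢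
      rcases hy with rfl | rfl | hy
      · simp
      · simp
      · exact Or.inr (Or.inr (hS y hy))
    · simp only [mem_insert, not_or]
      refine ⟨?_, ?_, hS0⟩
      · rintro rfl; simp at hxn
      · intro h
        have : x = 0 := by simpa using h.symm
        subst this; simp at hxn
    · rw [card_insert_of_notMem (by simp [hxn, hx.1]), card_insert_of_notMem hxS, hc]
      ring

/-- The Cayley graph of `A` with connection set `S`. -/
lemma regs_nonempty_of_symmetric {A : Type*} [AddCommGroup A] [Fintype A] {S : Finset A}
    (hneg : ∀ x ∈ S, -x ∈ S) (h0 : 0 ∉ S) : (regs A #S).Nonempty := by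
  let G : SimpleGraph A :=
    { Adj := fun u v => v - u ∈ S
      symm := ⟨fun u v h => by simpa using hneg _ h⟩
      loopless := ⟨fun u h => h0 (by simpa using h)⟩ }
  refine ⟨G, mem_regs.2 fun u => ?_⟩
  have : nbr G u = S.map (addLeftEmbedding u) := by
    ext v
    rw [mem_nbr, mem_map]
    constructor
    · intro h
      exact ⟨v - u, h, by simp⟩
    · rintro ⟨x, hx, rfl⟩
      simpa [G] using hx
  rw [this, card_map]

/-- There are `k`-regular graphs on `N` vertices whenever `kN` is even and `N > k`. -/
lemma regs_nonempty {k N : ℕ} (hN : k < N) (he : Even (k * N)) : (regs (Fin N) k).Nonempty := by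
  have : NeZero N := ⟨by omega⟩
  have h2 : #(univ.filter fun x : Fin N => x + x = 0) ≤ 2 := by
    refine (card_le_card (t := {0, Fin.ofNat N (N / 2)}) ?_).trans card_le_two
    intro x hx
    simp only [mem_filter, mem_univ, true_and, Fin.ext_iff, Fin.val_add, Fin.val_zero] at hx
    simp only [mem_insert, mem_singleton, Fin.ext_iff, Fin.val_zero, Fin.val_ofNat]
    have := x.isLt
    rw [Nat.mod_eq_of_lt (show N / 2 < N by omega)]
    obtain ⟨c, hc⟩ := Nat.dvd_of_mod_eq_zero hx
    have : c < 2 := by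
      by_contra h
      have := Nat.mul_le_mul_left N (show 2 ≤ c by omega)
      omega
    interval_cases c <;> omega
  rcases Nat.even_or_odd' k with ⟨m, rfl | rfl⟩
  · obtain ⟨S, h1, h3, h4⟩ := exists_symmetric_finset (S₀ := (∅ : Finset (Fin N))) (by simp)
      (by simp) (by convert h2) m (by simpa using hN)
    have := regs_nonempty_of_symmetric h1 h3
    rwa [h4, card_empty, zero_add] at this
  · have hNe : Even N := by
      rcases Nat.even_mul.1 he with h | h
      · exact absurd h (by simp)
      · exact h
    obtain ⟨c, hc⟩ := hNe
    have hval : (Fin.ofNat N c).val = c := by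
      rw [Fin.val_ofNat, Nat.mod_eq_of_lt (by omega)]
    -- For odd `k` the order `N` is even, and the involution `N / 2` supplies the unpaired element.
    obtain ⟨S, h1, h3, h4⟩ := exists_symmetric_finset (S₀ := ({Fin.ofNat N c} : Finset (Fin N)))
      (by
        intro x hx
        rw [mem_singleton] at hx ⊢
        rw [hx, neg_eq_iff_add_eq_zero, Fin.ext_iff, Fin.val_add, hval, ← hc]
        simp)
      (by
        rw [mem_singleton, Fin.ext_iff, hval, Fin.val_zero]
        omega) (by convert h2) m (by rw [card_singleton, Fintype.card_fin]; omega)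
    have := regs_nonempty_of_symmetric h1 h3
    rwa [h4, card_singleton, add_comm] at this

end Existence

/-! ### Sparsity of small sets, and the diameter bound -/

section Sparse

variable {V : Type*} [Fintype V]

lemma exists_of_not_isSparse {G : SimpleGraph V} {M ε : ℝ} (hε : 0 ≤ ε)
    (h : ¬ IsSparse G M ε) : ∃ S : Finset V, 1 ≤ #S ∧ (#S : ℝ) ≤ M ∧
      ∃ F ∈ powersetCard (#S + (⌊ε * #S⌋₊ + 1)) S.sym2, ∀ e ∈ F, e ∈ G.edgeSet := by
  simp only [IsSparse, not_forall, not_le] at h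
  obtain ⟨S, hM, hS⟩ := h
  refine ⟨S, ?_, hM, ?_⟩
  · rw [Nat.one_le_iff_ne_zero]
    intro h0
    rw [card_eq_zero] at h0
    subst h0
    simp [between] at hS
  · set E := (between G S S).image fun p => s(p.1, p.2) with hE
    have h1 : #(between G S S) ≤ 2 * #E := by
      have := card_pairs_le E (between G S S)
      rwa [filter_true_of_mem] at this
      exact fun p hp => mem_image_of_mem _ hp
    have h2 : #S + (⌊ε * #S⌋₊ + 1) ≤ #E := by
      have h3 : (#(between G S S) : ℝ) ≤ 2 * #E := by exact_mod_cast h1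
      have h4 := Nat.floor_le (mul_nonneg hε (Nat.cast_nonneg' (α := ℝ) #S))
      have : (#S : ℝ) + ⌊ε * #S⌋₊ < #E := by linarith
      have : #S + ⌊ε * #S⌋₊ < #E := by exact_mod_cast this
      omega
    obtain ⟨F, hF, hc⟩ := exists_subset_card_eq h2
    refine ⟨F, mem_powersetCard.2 ⟨hF.trans ?_, hc⟩, fun e he => ?_⟩
    · intro e he
      obtain ⟨⟨u, v⟩, hp, rfl⟩ := mem_image.1 he
      have := mem_between.1 hp
      simp [this.2.1, this.2.2]
    · obtain ⟨⟨u, v⟩, hp, rfl⟩ := mem_image.1 (hF he)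
      exact (mem_between.1 hp).1

/-- The union-bound weight of an `s`-set spanning `s + t` edges. The powers of `N` cancel except for
`N ^ (-t)`, and both factorials are absorbed by `s ^ n / n! ≤ exp s`. -/
lemma choose_mul_choose_mul_le {k N s t : ℕ} (hN : 0 < N) :
    (N.choose s : ℝ) * (((s ^ 2).choose (s + t) : ℕ) * (2 * k / N : ℝ) ^ (s + t)) ≤
      (2 * k * Real.exp 2) ^ s * (2 * k * s / N : ℝ) ^ t := by
  have hN' : (0 : ℝ) < N := by exact_mod_cast hN
  have h1 : (N.choose s : ℝ) ≤ (N : ℝ) ^ s / s.factorial := Nat.choose_le_pow_div s N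
  have h2 : ((s ^ 2).choose (s + t) : ℝ) ≤ ((s ^ 2 : ℕ) : ℝ) ^ (s + t) / (s + t).factorial :=
    Nat.choose_le_pow_div _ _
  have h3 := Real.pow_div_factorial_le_exp (s : ℝ) (Nat.cast_nonneg _) s
  have h4 := Real.pow_div_factorial_le_exp (s : ℝ) (Nat.cast_nonneg _) (s + t)
  calc (N.choose s : ℝ) * (((s ^ 2).choose (s + t) : ℕ) * (2 * k / N : ℝ) ^ (s + t))
      ≤ ((N : ℝ) ^ s / s.factorial) *
        ((((s ^ 2 : ℕ) : ℝ) ^ (s + t) / (s + t).factorial) * (2 * k / N : ℝ) ^ (s + t)) := by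
        gcongr
    _ = ((s : ℝ) ^ s / s.factorial) * ((s : ℝ) ^ (s + t) / (s + t).factorial) *
        ((2 * k) ^ s * (2 * k * s / N : ℝ) ^ t) := by
        push_cast
        have : (N : ℝ) ≠ 0 := hN'.ne'
        simp only [mul_pow, div_pow, pow_add]
        field_simp
        ring
    _ ≤ Real.exp s * Real.exp s * ((2 * k) ^ s * (2 * k * s / N : ℝ) ^ t) := by gcongr
    _ = _ := by
        have : Real.exp s * Real.exp s = Real.exp 2 ^ s := by
          rw [← Real.exp_add, ← Real.exp_nat_mul]; ring_nf
        rw [this, mul_pow (2 * (k : ℝ))]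
        ring

/-- Each excess edge earns `η ^ 2`. One half of these factors gives the overall `η`, as there is at
least one excess edge; the other half is at most `η ^ (ε * s)` and beats the exponential prefactor.
-/
lemma weight_le {k N s : ℕ} {M ε η : ℝ} (hN : 0 < N) (hη : 0 < η) (hη1 : η ≤ 1)
    (hM : 2 * k * M ≤ η ^ 2 * N) (hK : 2 * k * Real.exp 2 * η ^ ε ≤ 1 / 2) (hs : (s : ℝ) ≤ M) :
    (2 * k * Real.exp 2) ^ s * (2 * k * s / N : ℝ) ^ (⌊ε * s⌋₊ + 1) ≤ η * (1 / 2) ^ s := by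
  have hN' : (0 : ℝ) < N := by exact_mod_cast hN
  have h1 : (2 * k * s / N : ℝ) ≤ η ^ 2 := by
    rw [div_le_iff₀ hN']
    exact le_trans (by gcongr) hM
  have h2 : (η : ℝ) ^ (⌊ε * s⌋₊ + 1) ≤ (η ^ ε) ^ s := by
    rw [← Real.rpow_natCast, ← Real.rpow_mul_natCast hη.le]
    refine Real.rpow_le_rpow_of_exponent_ge hη hη1 ?_
    push_cast
    exact (Nat.lt_floor_add_one _).le
  calc (2 * k * Real.exp 2) ^ s * (2 * k * s / N : ℝ) ^ (⌊ε * s⌋₊ + 1)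
      ≤ (2 * k * Real.exp 2) ^ s * (η ^ 2) ^ (⌊ε * s⌋₊ + 1) := by gcongr
    _ = (2 * k * Real.exp 2) ^ s * (η ^ (⌊ε * s⌋₊ + 1) * η ^ (⌊ε * s⌋₊ + 1)) := by
        rw [← pow_mul, ← pow_add]; ring_nf
    _ ≤ (2 * k * Real.exp 2) ^ s * (η * (η ^ ε) ^ s) := by
        gcongr
        exact pow_le_of_le_one hη.le hη1 (Nat.succ_ne_zero _)
    _ = η * (2 * k * Real.exp 2 * η ^ ε) ^ s := by rw [mul_pow]; ring
    _ ≤ η * (1 / 2) ^ s := by gcongr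

lemma sum_half_pow_Icc_le (n : ℕ) : ∑ s ∈ Icc 1 n, ((1 : ℝ) / 2) ^ s ≤ 1 := by
  have h : ∑ s ∈ Icc 1 n, ((1 : ℝ) / 2) ^ s = 1 - (1 / 2) ^ n := by
    induction n with
    | zero => simp
    | succ n ih =>
      rw [sum_Icc_succ_top (by omega), ih, pow_succ]
      ring
  rw [h]
  have : (0 : ℝ) ≤ (1 / 2) ^ n := by positivity
  linarith

/-- All but a fraction `η` of the regular graphs are sparse. -/
lemma card_not_isSparse_le {k : ℕ} {M ε η : ℝ} (hV : 0 < Fintype.card V) (hε : 0 ≤ ε)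
    (hε1 : ε ≤ 1) (hη : 0 < η) (hη1 : η ≤ 1) (hM : 2 * k * M ≤ η ^ 2 * Fintype.card V)
    (hK : 2 * k * Real.exp 2 * η ^ ε ≤ 1 / 2)
    (hN : 8 * M + 4 + 8 * k ^ 2 ≤ k * Fintype.card V) :
    (#{G ∈ regs V k | ¬ IsSparse G M ε} : ℝ) ≤ η * #(regs V k) := by
  set N := Fintype.card V with hNdef
  have hN' : (0 : ℝ) < N := by exact_mod_cast hV
  have hsub : {G ∈ regs V k | ¬ IsSparse G M ε} ⊆ (Icc 1 ⌊M⌋₊).biUnion fun s =>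
      (powersetCard s (univ : Finset V)).biUnion fun S =>
        (powersetCard (s + (⌊ε * s⌋₊ + 1)) S.sym2).biUnion fun F => regsWith k F := by
    intro G hG
    obtain ⟨hreg, hns⟩ := mem_filter.1 hG
    obtain ⟨S, h1, h2, F, hF, hFG⟩ := exists_of_not_isSparse hε hns
    simp only [mem_biUnion]
    refine ⟨#S, mem_Icc.2 ⟨h1, Nat.le_floor h2⟩, S, mem_powersetCard.2 ⟨subset_univ _, rfl⟩,
      F, hF, mem_filter.2 ⟨hreg, hFG⟩⟩
  have hterm : ∀ s ∈ Icc 1 ⌊M⌋₊, (#((powersetCard s (univ : Finset V)).biUnion fun S =>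
      (powersetCard (s + (⌊ε * s⌋₊ + 1)) S.sym2).biUnion fun F => regsWith k F) : ℝ) ≤
      η * #(regs V k) * (1 / 2) ^ s := by
    intro s hs
    obtain ⟨hs1, hs2⟩ := mem_Icc.1 hs
    have hsM : (s : ℝ) ≤ M := (Nat.le_floor_iff' (by omega)).1 hs2
    set f := s + (⌊ε * s⌋₊ + 1) with hf
    have hF : ∀ S ∈ powersetCard s (univ : Finset V), ∀ F ∈ powersetCard f S.sym2,
        (#(regsWith k F) : ℝ) ≤ (2 * k / N : ℝ) ^ f * #(regs V k) := by
      intro S _ F hF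
      obtain ⟨-, hFc⟩ := mem_powersetCard.1 hF
      have hfl := Nat.floor_le (mul_nonneg hε (Nat.cast_nonneg' (α := ℝ) s))
      have hεs : ε * s ≤ s := mul_le_of_le_one_left (Nat.cast_nonneg _) hε1
      have hle : (4 * #F + 8 * k ^ 2 : ℝ) ≤ k * N := by
        rw [hFc, hf]; push_cast; linarith
      have h := card_regsWith_le (V := V) F (k := k) (by exact_mod_cast hle)
      rw [hFc] at h
      have h' : (#(regsWith k F) : ℝ) * (N : ℝ) ^ f ≤ (2 * k) ^ f * #(regs V k) := by
        exact_mod_cast h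
      rw [div_pow, div_mul_eq_mul_div, le_div_iff₀ (by positivity)]
      exact h'
    calc _ ≤ ∑ S ∈ powersetCard s (univ : Finset V), ∑ F ∈ powersetCard f S.sym2,
          (#(regsWith k F) : ℝ) := by
          refine le_trans (Nat.cast_le.2 card_biUnion_le) ?_
          rw [Nat.cast_sum]
          refine sum_le_sum fun S _ => le_trans (Nat.cast_le.2 card_biUnion_le) ?_
          rw [Nat.cast_sum]
      _ ≤ ∑ S ∈ powersetCard s (univ : Finset V),
          ((s ^ 2).choose f : ℝ) * ((2 * k / N : ℝ) ^ f * #(regs V k)) := by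
          refine sum_le_sum fun S hS => (sum_le_card_nsmul _ _ _ (hF S hS)).trans ?_
          rw [card_powersetCard, nsmul_eq_mul]
          have hS2 : #S.sym2 ≤ s ^ 2 := by
            rw [card_sym2, (mem_powersetCard.1 hS).2, Nat.choose_two_right]
            have h0 : (s + 1) * (s + 1 - 1) ≤ 2 * s ^ 2 := by
              rw [Nat.add_sub_cancel]; nlinarith
            omega
          gcongr
      _ = ((N.choose s : ℝ) * (((s ^ 2).choose f : ℝ) * (2 * k / N : ℝ) ^ f)) *
          #(regs V k) := by
          rw [sum_const, card_powersetCard, card_univ, nsmul_eq_mul]; ring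
      _ ≤ (η * (1 / 2) ^ s) * #(regs V k) := by
          refine mul_le_mul_of_nonneg_right ?_ (Nat.cast_nonneg _)
          exact (choose_mul_choose_mul_le hV).trans (weight_le hV hη hη1 hM hK hsM)
      _ = _ := by ring
  calc (#{G ∈ regs V k | ¬ IsSparse G M ε} : ℝ) ≤ _ := Nat.cast_le.2 (card_le_card hsub)
    _ ≤ ∑ s ∈ Icc 1 ⌊M⌋₊, η * #(regs V k) * (1 / 2) ^ s := by
        refine le_trans (Nat.cast_le.2 card_biUnion_le) ?_
        rw [Nat.cast_sum]
        exact sum_le_sum hterm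
    _ = η * #(regs V k) * ∑ s ∈ Icc 1 ⌊M⌋₊, (1 / 2) ^ s := by rw [mul_sum]
    _ ≤ η * #(regs V k) * 1 := by
        gcongr
        exact sum_half_pow_Icc_le _
    _ = _ := mul_one _

/-- Any two vertices are joined by a walk of length at most `D`. -/
def DiamLE (G : SimpleGraph V) (D : ℕ) : Prop := ∀ x y, y ∈ ball G x D

/-- All but a small fraction of the regular graphs have diameter at most `2r+1`. -/
lemma card_not_forall_mem_ball_le {k r m J : ℕ} (hk : 3 ≤ k) {M ε η : ℝ}
    (hV : 0 < Fintype.card V) (hε : 0 ≤ ε) (hε1 : ε ≤ 1 / 4) (hη : 0 < η) (hη1 : η ≤ 1)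
    (hM : 2 * k * M ≤ η ^ 2 * Fintype.card V)
    (hK : 2 * k * Real.exp 2 * η ^ ε ≤ 1 / 2)
    (hN : 8 * M + 4 + 8 * k ^ 2 ≤ k * Fintype.card V)
    (hr : 4 * ((k : ℝ) - 1) ^ r ≤ M) (hm : 4 * m ≤ ((k : ℝ) - 1 - k * ε) ^ r)
    (hJ : J + 3 * k ^ 2 ≤ m) :
    (#{G ∈ regs V k | ¬ DiamLE G (2 * r + 1)} : ℝ) ≤
      (η + Fintype.card V ^ 2 * (J * (k * Fintype.card V) / m ^ 2 : ℝ) ^ J) * #(regs V k) := by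
  have hk' : (3 : ℝ) ≤ k := by exact_mod_cast hk
  have hsub : {G ∈ regs V k | ¬ DiamLE G (2 * r + 1)} ⊆
      {G ∈ regs V k | ¬ IsSparse G M ε} ∪
        (univ : Finset (V × V)).biUnion fun p => farClass k (2 * m) r p.1 p.2 0 := by
    intro G hG
    obtain ⟨hreg, hG⟩ := mem_filter.1 hG
    rw [mem_union, mem_filter]
    by_cases hs : IsSparse G M ε
    · simp only [DiamLE, not_forall] at hG
      obtain ⟨x, y, hxy⟩ := hG
      right
      obtain ⟨h1, h2⟩ := disjoint_ball_of_notMem hxy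
      have hball : ∀ z, #(between G (ball G z r) (ball G z r)) + 2 * m ≤ k * #(ball G z r) := by
        intro z
        have hzM : (#(ball G z r) : ℝ) ≤ M := by
          refine le_trans ?_ hr
          have : (#(ball G z r) : ℝ) ≤ ((4 * (k - 1) ^ r : ℕ) : ℝ) :=
            Nat.cast_le.2 (card_ball_le hk hreg z r)
          push_cast [Nat.cast_sub (show 1 ≤ k by omega)] at this
          exact this
        -- Having `2 * m` outgoing edges needs `4 * m` vertices, hence the `4` in `hm`.
        refine hs.card_between_add_le hk hε1 hzM ?_
        have := hm.trans (hs.pow_le_card_ball hreg hε (by linarith) (by nlinarith) z r hzM)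
        have : 4 * m ≤ #(ball G z r) := by exact_mod_cast this
        omega
      refine mem_biUnion.2 ⟨(x, y), mem_univ _, mem_filter.2 ⟨hreg, h1, hball x, hball y, ?_⟩⟩
      rw [h2, card_empty]
    · exact Or.inl ⟨hreg, hs⟩
  have hm0 : (0 : ℝ) < m := by
    have : 0 < 3 * k ^ 2 := by positivity
    exact_mod_cast (by omega : 0 < m)
  have hfar : ∀ p ∈ (univ : Finset (V × V)), (#(farClass k (2 * m) r p.1 p.2 0) : ℝ) ≤
      (J * (k * Fintype.card V) / m ^ 2 : ℝ) ^ J * #(regs V k) := by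
    intro p _
    have h := card_farClass_zero_le (V := V) k m r J p.1 p.2 hJ
    have h' : (#(farClass k (2 * m) r p.1 p.2 0) : ℝ) * ((m : ℝ) ^ 2) ^ J ≤
        #(regs V k) * (J * (k * Fintype.card V)) ^ J := by exact_mod_cast h
    rw [div_pow, div_mul_eq_mul_div, le_div_iff₀ (by positivity), mul_comm (_ ^ J) (#(regs V k) : ℝ)]
    exact h'
  calc (#{G ∈ regs V k | ¬ DiamLE G (2 * r + 1)} : ℝ)
      ≤ #{G ∈ regs V k | ¬ IsSparse G M ε} + ∑ p : V × V,
          (#(farClass k (2 * m) r p.1 p.2 0) : ℝ) := by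
        have := (card_le_card hsub).trans ((card_union_le _ _).trans
          (Nat.add_le_add_left card_biUnion_le _))
        exact_mod_cast this
    _ ≤ η * #(regs V k) + Fintype.card V ^ 2 *
          ((J * (k * Fintype.card V) / m ^ 2 : ℝ) ^ J * #(regs V k)) := by
        refine add_le_add (card_not_isSparse_le hV hε (by linarith) hη hη1 hM hK hN) ?_
        refine (sum_le_card_nsmul _ _ _ hfar).trans (le_of_eq ?_)
        rw [card_univ, Fintype.card_prod, nsmul_eq_mul]
        push_cast
        ring
    _ = _ := by ring

end Sparse

open Filter

/-! ### Choice of parameters for large `N` -/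

section Asymptotics

open Filter

lemma exp_neg_two_mul_le {x : ℝ} (h0 : 0 ≤ x) (h1 : x ≤ 1 / 2) : Real.exp (-(2 * x)) ≤ 1 - x := by
  have h2 := Real.add_one_le_exp (2 * x)
  rw [Real.exp_neg, inv_le_iff_one_le_mul₀ (Real.exp_pos _)]
  nlinarith

/-- As `k ≤ 2 * (k - 1)`, each step keeps a fraction at least `1 - 2 * ε ≥ exp (-4 * ε)` of the full
growth. The total loss is bounded when `ε * r` is. -/
lemma exp_mul_pow_le {k r : ℕ} (hk : 3 ≤ k) {ε a : ℝ} (hε : 0 ≤ ε) (hε1 : ε ≤ 1 / 4)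
    (ha : 4 * (ε * r) ≤ a) :
    Real.exp (-a) * ((k : ℝ) - 1) ^ r ≤ ((k : ℝ) - 1 - k * ε) ^ r := by
  have hk' : (3 : ℝ) ≤ k := by exact_mod_cast hk
  calc Real.exp (-a) * ((k : ℝ) - 1) ^ r
      ≤ Real.exp (-(2 * (2 * ε))) ^ r * ((k : ℝ) - 1) ^ r := by
        rw [← Real.exp_nat_mul]
        have : -a ≤ r * -(2 * (2 * ε)) := by linarith
        have : (0 : ℝ) ≤ k - 1 := by linarith
        gcongr
    _ ≤ (1 - 2 * ε) ^ r * ((k : ℝ) - 1) ^ r := by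
        have : (0 : ℝ) ≤ k - 1 := by linarith
        gcongr
        exact exp_neg_two_mul_le (by linarith) (by linarith)
    _ = ((1 - 2 * ε) * (k - 1)) ^ r := (mul_pow _ _ _).symm
    _ ≤ ((k : ℝ) - 1 - k * ε) ^ r := by
        refine pow_le_pow_left₀ (mul_nonneg (by linarith) (by linarith)) ?_ r
        nlinarith

lemma natCast_le_two_mul_log {q : ℝ} (hq : 2 ≤ q) {n : ℕ} {N : ℝ} (h : q ^ n ≤ N) :
    (n : ℝ) ≤ 2 * Real.log N := by
  have hpos : 0 < q ^ n := pow_pos (by linarith) n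
  have h1 := Real.log_le_log hpos h
  rw [Real.log_pow] at h1
  have h2 : Real.log 2 ≤ Real.log q := Real.log_le_log two_pos hq
  have h3 := Real.log_two_gt_d9
  have : (n : ℝ) * (1 / 2) ≤ n * Real.log q := by
    gcongr
    linarith
  linarith

/-- The ratio is at most `256 * k / (c ^ 2 * log N) ≤ exp (-1)`, and `J ≥ 3 * log N` powers of it
give `N⁻³` against the `N ^ 2` pairs. The factor `log N` in `m` is what makes the ratio small. -/
lemma sq_mul_ratio_pow_le {k N J m : ℕ} {c : ℝ} (hN : (0 : ℝ) < N)
    (hL : 256 * k * Real.exp 1 / c ^ 2 ≤ Real.log N) (hL0 : 0 < Real.log N) (hc : 0 < c)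
    (hJ : (J : ℝ) ≤ 4 * Real.log N) (hJ' : 3 * Real.log N ≤ J)
    (hm : c * (√(N : ℝ) * Real.log N) / 8 ≤ m) :
    (N : ℝ) ^ 2 * (J * (k * N) / m ^ 2 : ℝ) ^ J ≤ (N : ℝ)⁻¹ := by
  have hratio : (J * (k * N) / m ^ 2 : ℝ) ≤ Real.exp (-1) := by
    have hsq : √(N : ℝ) ^ 2 = N := Real.sq_sqrt hN.le
    have hs0 : 0 < √(N : ℝ) := Real.sqrt_pos.2 hN
    have hm0 : (0 : ℝ) < m := lt_of_lt_of_le (by positivity) hm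
    rw [div_le_iff₀ (by positivity)]
    have h1 : (256 * k * Real.exp 1) ≤ Real.log N * c ^ 2 := (div_le_iff₀ (by positivity)).1 hL
    have h2 : (c * (√(N : ℝ) * Real.log N) / 8) ^ 2 ≤ (m : ℝ) ^ 2 := by gcongr
    have h3 : (c * (√(N : ℝ) * Real.log N) / 8) ^ 2 = c ^ 2 * (N * Real.log N ^ 2) / 64 := by
      rw [div_pow, mul_pow, mul_pow, hsq]; norm_num
    calc (J * (k * N) : ℝ) ≤ 4 * Real.log N * (k * N) := by gcongr
      _ = Real.exp (-1) * ((256 * k * Real.exp 1) * (Real.log N * N) / 64) := by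
        rw [Real.exp_neg]; field_simp; ring
      _ ≤ Real.exp (-1) * ((Real.log N * c ^ 2) * (Real.log N * N) / 64) := by gcongr
      _ = Real.exp (-1) * (c * (√(N : ℝ) * Real.log N) / 8) ^ 2 := by rw [h3]; ring
      _ ≤ _ := by gcongr
  calc (N : ℝ) ^ 2 * (J * (k * N) / m ^ 2 : ℝ) ^ J ≤ N ^ 2 * Real.exp (-1) ^ J := by gcongr
    _ ≤ N ^ 2 * Real.exp (-(3 * Real.log N)) := by
      rw [← Real.exp_nat_mul]
      gcongr
      linarith
    _ = (N : ℝ)⁻¹ := by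
      have : Real.exp (-(3 * Real.log N)) = ((N : ℝ) ^ 3)⁻¹ := by
        rw [Real.exp_neg, show 3 * Real.log N = ((3 : ℕ) : ℝ) * Real.log N by norm_num,
          Real.exp_nat_mul, Real.exp_log hN]
      rw [this]
      field_simp

lemma two_mul_mul_rpow_div {k N : ℝ} (hk : 0 < k) (hN : 0 < N) :
    2 * k * (N ^ (3 / 4 : ℝ) / (2 * k)) = (N ^ (-(1 / 8) : ℝ)) ^ 2 * N := by
  have h : (N ^ (-(1 / 8) : ℝ)) ^ 2 * N = N ^ (3 / 4 : ℝ) := by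
    rw [← Real.rpow_mul_natCast hN.le]
    nth_rewrite 2 [← Real.rpow_one N]
    rw [← Real.rpow_add hN]
    norm_num
  rw [h]
  field_simp

lemma mul_rpow_rpow {k N a : ℝ} (hk : 0 < k) (hN : 0 < N) (hL : 0 < Real.log N)
    (ha : a = Real.log (2 * (2 * k * Real.exp 2))) :
    2 * k * Real.exp 2 * (N ^ (-(1 / 8) : ℝ)) ^ (8 * a / Real.log N) = 1 / 2 := by
  have : (N ^ (-(1 / 8) : ℝ)) ^ (8 * a / Real.log N) = (2 * (2 * k * Real.exp 2))⁻¹ := by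
    rw [← Real.rpow_mul hN.le, Real.rpow_def_of_pos hN,
      show Real.log N * (-(1 / 8) * (8 * a / Real.log N)) = -a by field_simp, Real.exp_neg, ha,
      Real.exp_log (by positivity)]
  rw [this]
  have := Real.exp_pos 2
  field_simp

lemma four_mul_pow_succ_le {k y : ℝ} {n : ℕ} (hk : 1 < k)
    (h : (k - 1) ^ n ≤ y / (8 * (k - 1) * k)) : 4 * (k - 1) ^ (n + 1) ≤ y / (2 * k) := by
  have h1 : 0 < k - 1 := by linarith
  calc 4 * (k - 1) ^ (n + 1) = 4 * (k - 1) * (k - 1) ^ n := by ring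
    _ ≤ 4 * (k - 1) * (y / (8 * (k - 1) * k)) := by gcongr
    _ = y / (2 * k) := by
      field_simp
      ring

/-- The quantitative form, for all `N` satisfying explicit largeness conditions. -/
lemma exists_radius_of_large {k N : ℕ} (hk : 3 ≤ k) {a c : ℝ}
    (ha : a = Real.log (2 * (2 * k * Real.exp 2))) (hc : c = Real.exp (-(96 * a)))
    (hL1 : 1 ≤ Real.log N) (hL2 : 32 * a ≤ Real.log N)
    (hL3 : 256 * k * Real.exp 1 / c ^ 2 ≤ Real.log N)
    (hN : (4 + 8 * k ^ 2 : ℝ) ≤ N) (hsqrt : (8 + 4 * (5 + 3 * k ^ 2)) / c ≤ √(N : ℝ))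
    (hlog : Real.log N ≤ (1 / (8 * (k - 1) * k)) * (N : ℝ) ^ (1 / 4 : ℝ)) :
    ∃ r : ℕ, ((k : ℝ) - 1) ^ (2 * r + 1) ≤ (k - 1) ^ 3 * (N * Real.log N ^ 2) ∧
      (2 * r + 2 : ℝ) ≤ 8 * Real.log N ∧
      (#{G ∈ regs (Fin N) k | ¬ DiamLE G (2 * r + 1)} : ℝ) ≤
        ((N : ℝ) ^ (-(1 / 8) : ℝ) + (N : ℝ)⁻¹) * #(regs (Fin N) k) := by
  have hk' : (3 : ℝ) ≤ k := by exact_mod_cast hk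
  set L := Real.log N with hL
  have hN1 : (1 : ℝ) ≤ N := by linarith [sq_nonneg (k : ℝ)]
  have hN0 : (0 : ℝ) < N := by linarith
  have hc0 : 0 < c := hc ▸ Real.exp_pos _
  set X := √(N : ℝ) * L with hX
  have hs1 : 1 ≤ √(N : ℝ) := Real.one_le_sqrt.2 hN1
  have hX1 : 1 ≤ X := one_le_mul_of_one_le_of_one_le hs1 hL1
  have hsq : √(N : ℝ) * √(N : ℝ) = N := Real.mul_self_sqrt hN0.le
  have hsr : √(N : ℝ) = (N : ℝ) ^ (1 / 2 : ℝ) := Real.sqrt_eq_rpow _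
  have hXN : X ≤ N ^ (3 / 4 : ℝ) / (8 * (k - 1) * k) := by
    have e : (N : ℝ) ^ (3 / 4 : ℝ) = √(N : ℝ) * N ^ (1 / 4 : ℝ) := by
      rw [hsr, ← Real.rpow_add hN0]; norm_num
    rw [e, hX]
    calc √(N : ℝ) * L ≤ √(N : ℝ) * ((1 / (8 * (k - 1) * k)) * (N : ℝ) ^ (1 / 4 : ℝ)) := by gcongr
      _ = _ := by ring
  have h34 : (N : ℝ) ^ (3 / 4 : ℝ) ≤ N := by
    simpa using Real.rpow_le_rpow_of_exponent_le hN1 (show (3 / 4 : ℝ) ≤ 1 by norm_num)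
  have hXN' : X ≤ N := by
    refine hXN.trans ((div_le_self (by positivity) ?_).trans h34)
    exact one_le_mul_of_one_le_of_one_le (by linarith) (by linarith)
  -- With `r = n + 1`, `(k - 1) ^ r` exceeds `X = √N log N`, while `(k - 1) ^ (2 * r + 1)` is `(k -
  -- 1) ^ 3` times the square of `(k - 1) ^ n ≤ X`.
  obtain ⟨n, hn1, hn2⟩ := exists_nat_pow_near hX1 (show (1 : ℝ) < (k : ℝ) - 1 by linarith)
  have hn : (n : ℝ) ≤ 2 * L := natCast_le_two_mul_log (by linarith) (hn1.trans hXN')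
  have ha0 : 0 < a := by
    rw [ha]
    refine Real.log_pos ?_
    have h2 : (1 : ℝ) < Real.exp 2 := Real.one_lt_exp_iff.2 two_pos
    have h3 : (1 : ℝ) * 1 < 2 * k * Real.exp 2 := by gcongr; linarith
    linarith
  refine ⟨n + 1, ?_, ?_, ?_⟩
  · calc ((k : ℝ) - 1) ^ (2 * (n + 1) + 1) = (k - 1) ^ 3 * ((k - 1) ^ n) ^ 2 := by ring
      _ ≤ (k - 1) ^ 3 * X ^ 2 := by
        have : (0 : ℝ) ≤ k - 1 := by linarith
        gcongr
      _ = (k - 1) ^ 3 * (√(N : ℝ) * √(N : ℝ) * L ^ 2) := by rw [hX]; ring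
      _ = _ := by rw [hsq]
  · push_cast; linarith
  set ε := 8 * a / L with hε
  have hL0 : 0 < L := by linarith
  have hε0 : 0 ≤ ε := by positivity
  have hεL : ε * L = 8 * a := div_mul_cancel₀ _ hL0.ne'
  have hε1 : ε ≤ 1 / 4 := by
    rw [hε, div_le_iff₀ hL0]; linarith
  set m := ⌊c * X / 4⌋₊ with hm
  set J := ⌈3 * L⌉₊ with hJ
  have hJ4 : (J : ℝ) ≤ 4 * L := by
    have := (Nat.ceil_lt_add_one (show 0 ≤ 3 * L by positivity)).le
    linarith
  have hcs : 8 + 4 * (5 + 3 * (k : ℝ) ^ 2) ≤ √(N : ℝ) * c := (div_le_iff₀ hc0).1 hsqrt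
  have hcX : (8 + 4 * (5 + 3 * (k : ℝ) ^ 2)) * L ≤ c * X := by
    calc _ ≤ (√(N : ℝ) * c) * L := by gcongr
      _ = _ := by rw [hX]; ring
  have hmle : (m : ℝ) ≤ c * X / 4 := Nat.floor_le (by positivity)
  have hmlt : c * X / 4 < m + 1 := Nat.lt_floor_add_one _
  have hkL : 0 ≤ (k : ℝ) ^ 2 * (L - 1) := mul_nonneg (sq_nonneg _) (by linarith)
  have hm8 : c * X / 8 ≤ m := by linarith [mul_nonneg (sq_nonneg (k : ℝ)) hL0.le]
  have hpow : c * X ≤ ((k : ℝ) - 1 - k * ε) ^ (n + 1) := by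
    -- Source of the `96` in `c`: `ε * L = 8 * a` and `n + 1 ≤ 3 * L`.
    have h1 : 4 * (ε * ((n + 1 : ℕ) : ℝ)) ≤ 96 * a := by
      have : ε * ((n + 1 : ℕ) : ℝ) ≤ ε * (3 * L) := by
        gcongr
        push_cast
        linarith
      linarith
    refine le_trans ?_ (exp_mul_pow_le hk hε0 hε1 h1)
    rw [← hc]
    gcongr
  have hJm : J + 3 * k ^ 2 ≤ m := by
    have : (J : ℝ) + 3 * k ^ 2 ≤ m := by linarith [mul_nonneg (sq_nonneg (k : ℝ)) hL0.le]
    exact_mod_cast this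
  have key := card_not_forall_mem_ball_le (V := Fin N) (r := n + 1) (m := m) (J := J)
    (M := N ^ (3 / 4 : ℝ) / (2 * k)) (ε := ε) (η := (N : ℝ) ^ (-(1 / 8) : ℝ)) hk
    (by rw [Fintype.card_fin]; exact_mod_cast hN0) hε0 hε1 (by positivity)
    (Real.rpow_le_one_of_one_le_of_nonpos hN1 (by norm_num))
    ?_ ?_ ?_ ?_ (by linarith) hJm
  · refine key.trans ?_
    rw [Fintype.card_fin]
    gcongr
    exact sq_mul_ratio_pow_le hN0 hL3 hL0 hc0 hJ4 (Nat.le_ceil _) hm8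
  · rw [Fintype.card_fin]
    exact (two_mul_mul_rpow_div (by positivity) hN0).le
  · exact (mul_rpow_rpow (by positivity) hN0 hL0 ha).le
  · rw [Fintype.card_fin]
    have : (N : ℝ) ^ (3 / 4 : ℝ) / (2 * k) ≤ N / 6 :=
      div_le_div₀ hN0.le h34 (by norm_num) (by linarith)
    have : (3 : ℝ) * N ≤ k * N := by gcongr
    linarith
  · exact four_mul_pow_succ_le (by linarith) (hn1.trans hXN)

/-- With high probability the diameter is at most `2r+1` with `(k-1)^(2r+1)` of order
`N log² N`. -/
lemma eventually_exists_radius {k : ℕ} (hk : 3 ≤ k) : ∀ᶠ N : ℕ in atTop,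
    1 ≤ Real.log N ∧
    ∃ r : ℕ, ((k : ℝ) - 1) ^ (2 * r + 1) ≤ (k - 1) ^ 3 * (N * Real.log N ^ 2) ∧
      (2 * r + 2 : ℝ) ≤ 8 * Real.log N ∧
      (#{G ∈ regs (Fin N) k | ¬ DiamLE G (2 * r + 1)} : ℝ) ≤
        ((N : ℝ) ^ (-(1 / 8) : ℝ) + (N : ℝ)⁻¹) * #(regs (Fin N) k) := by
  have hk' : (3 : ℝ) ≤ k := by exact_mod_cast hk
  have hcast := tendsto_natCast_atTop_atTop (R := ℝ)
  have hlog := Real.tendsto_log_atTop.comp hcast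
  have hsqrt := Real.tendsto_sqrt_atTop.comp hcast
  have hpos : (0 : ℝ) < 1 / (8 * (k - 1) * k) := by
    have : (0 : ℝ) < k - 1 := by linarith
    positivity
  have hlo := hcast.eventually
    ((isLittleO_log_rpow_atTop (show (0 : ℝ) < 1 / 4 by norm_num)).bound hpos)
  -- The thresholds `_` are fixed by unification when `exists_radius_of_large` is applied.
  filter_upwards [hlog.eventually_ge_atTop 1, hlog.eventually_ge_atTop _,
    hlog.eventually_ge_atTop _, hcast.eventually_ge_atTop _, hsqrt.eventually_ge_atTop _, hlo]
    with N h1 h2 h3 h4 h5 h6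
  simp only [Function.comp_apply] at h1 h2 h3 h5
  refine ⟨h1, exists_radius_of_large hk rfl rfl h1 h2 h3 h4 h5 ?_⟩
  rwa [Real.norm_of_nonneg (by linarith), Real.norm_of_nonneg (by positivity)] at h6

end Asymptotics

/-! ### Transfer to `regularProb` and the final constant -/

section Probability

lemma regularGraphs_eq (k N : ℕ) : regularGraphs k N = ↑(regs (Fin N) k) := by
  ext G
  simp only [regularGraphs, SimpleGraph.IsRegularOfDegree, Set.mem_ofPred_eq, coe_filter, regs,
    mem_univ, true_and, ← SimpleGraph.card_neighborFinset_eq_degree]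
  refine forall_congr' fun v => ?_
  rw [show nbr G v = G.neighborFinset v by ext w; simp]

lemma regularProb_eq (k N : ℕ) (P : SimpleGraph (Fin N) → Prop) :
    regularProb k N P = #{G ∈ regs (Fin N) k | P G} / #(regs (Fin N) k) := by
  rw [regularProb, regularGraphs_eq, Set.ncard_coe_finset]
  congr 2
  rw [← Set.ncard_coe_finset]
  simp

lemma regularProb_le_one (k N : ℕ) (P : SimpleGraph (Fin N) → Prop) : regularProb k N P ≤ 1 := by
  rw [regularProb_eq]
  exact div_le_one_of_le₀ (Nat.cast_le.2 (card_le_card (filter_subset _ _))) (Nat.cast_nonneg _)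

lemma one_sub_le_regularProb {k N : ℕ} {P Q : SimpleGraph (Fin N) → Prop} {δ : ℝ}
    (hne : (regs (Fin N) k).Nonempty)
    (hQ : (#{G ∈ regs (Fin N) k | ¬ Q G} : ℝ) ≤ δ * #(regs (Fin N) k))
    (hPQ : ∀ G ∈ regs (Fin N) k, Q G → P G) : 1 - δ ≤ regularProb k N P := by
  have hpos : (0 : ℝ) < #(regs (Fin N) k) := by exact_mod_cast hne.card_pos
  rw [regularProb_eq, le_div_iff₀ hpos]
  have h1 : (#{G ∈ regs (Fin N) k | Q G} : ℝ) + #{G ∈ regs (Fin N) k | ¬ Q G} =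
      #(regs (Fin N) k) := by exact_mod_cast card_filter_add_card_filter_not _
  have h2 : (#{G ∈ regs (Fin N) k | Q G} : ℝ) ≤ #{G ∈ regs (Fin N) k | P G} := by
    refine Nat.cast_le.2 (card_le_card fun G hG => ?_)
    obtain ⟨h, h'⟩ := mem_filter.1 hG
    exact mem_filter.2 ⟨h, hPQ G h h'⟩
  linarith

lemma maxVertexFlow_lt {k N r : ℕ} (hk : 3 ≤ k) (hN : 0 < N) (hL : 1 ≤ Real.log N)
    (hr : ((k : ℝ) - 1) ^ (2 * r + 1) ≤ (k - 1) ^ 3 * (N * Real.log N ^ 2))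
    (hr' : (2 * r + 2 : ℝ) ≤ 8 * Real.log N) {G : SimpleGraph (Fin N)}
    (hG : G ∈ regs (Fin N) k) (hD : DiamLE G (2 * r + 1))
    (o : Fin N → Fin N → Prop) :
    maxVertexFlow G o < (k : ℝ) ^ (10 : ℝ) * ((N : ℝ) * Real.logb k N ^ 3) := by
  have hk' : (3 : ℝ) ≤ k := by exact_mod_cast hk
  have hN' : (0 : ℝ) < N := by exact_mod_cast hN
  have : Nonempty (Fin N) := ⟨⟨0, hN⟩⟩
  have hlk : 0 < Real.log k := Real.log_pos (by linarith)
  have hlk' : Real.log k ≤ k := (Real.log_le_sub_one_of_pos (by linarith)).trans (by linarith)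
  have h1 : maxVertexFlow G o ≤ 64 * (k - 1) ^ 3 * (N * Real.log N ^ 3) := by
    refine ciSup_le fun v => (vertexFlow_le hk hG hD o v).trans ?_
    have : (0 : ℝ) ≤ k - 1 := by linarith
    calc 8 * (((2 * r + 1 : ℕ) : ℝ) + 1) * ((k : ℝ) - 1) ^ (2 * r + 1)
        = 8 * (2 * r + 2) * ((k : ℝ) - 1) ^ (2 * r + 1) := by push_cast; ring
      _ ≤ 8 * (8 * Real.log N) * ((k - 1) ^ 3 * (N * Real.log N ^ 2)) := by gcongr
      _ = _ := by ring
  have h2 : Real.log N = Real.log k * Real.logb k N := by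
    rw [Real.logb, mul_div_cancel₀ _ hlk.ne']
  have h3 : 0 < Real.logb k N := by
    rw [Real.logb]; positivity
  -- The exponent is `4 + 3 + 3`, from `64 ≤ k ^ 4`, `(k - 1) ^ 3 < k ^ 3` and `log k ≤ k`; the
  -- middle one makes the final inequality strict.
  have h4 : 64 * ((k : ℝ) - 1) ^ 3 * Real.log k ^ 3 < (k : ℝ) ^ (10 : ℝ) := by
    have e : (k : ℝ) ^ (10 : ℝ) = k ^ 4 * k ^ 3 * k ^ 3 := by
      rw [show (10 : ℝ) = ((10 : ℕ) : ℝ) by norm_num, Real.rpow_natCast]; ring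
    rw [e]
    have h64 : (64 : ℝ) ≤ k ^ 4 := by
      calc (64 : ℝ) ≤ 3 ^ 4 := by norm_num
        _ ≤ (k : ℝ) ^ 4 := by gcongr
    have h5 : ((k : ℝ) - 1) ^ 3 < (k : ℝ) ^ 3 :=
      pow_lt_pow_left₀ (by linarith) (by linarith) (by norm_num)
    have h6 : Real.log k ^ 3 ≤ (k : ℝ) ^ 3 := by gcongr
    calc 64 * ((k : ℝ) - 1) ^ 3 * Real.log k ^ 3 < 64 * (k : ℝ) ^ 3 * Real.log k ^ 3 := by gcongr
      _ ≤ (k : ℝ) ^ 4 * k ^ 3 * k ^ 3 := by gcongr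
  calc maxVertexFlow G o ≤ 64 * (k - 1) ^ 3 * (N * Real.log N ^ 3) := h1
    _ = (64 * ((k : ℝ) - 1) ^ 3 * Real.log k ^ 3) * (N * Real.logb k N ^ 3) := by rw [h2]; ring
    _ < _ := by gcongr

end Probability

end GeodesicFlow

end

theorem mainTheorem5 (k : ℕ) (hk : 3 ≤ k) :
    ∃ (C : ℝ) (g : ℕ → ℝ),
      Asymptotics.IsLittleO Filter.atTop g
        (fun N : ℕ => (N : ℝ) * Real.logb (k : ℝ) (N : ℝ) ^ 3) ∧
      Filter.Tendsto
        (fun N : ℕ => GeodesicFlow.regularProb k N (fun G =>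
          G.Connected ∧
          ∀ r : Fin N → Fin N → Prop, GeodesicFlow.IsPairOrientation r →
            GeodesicFlow.maxVertexFlow G r <
              (k : ℝ) ^ C * ((N : ℝ) * Real.logb (k : ℝ) (N : ℝ) ^ 3) + g N))
        (Filter.atTop ⊓ Filter.principal {N : ℕ | Even (k * N)})
        (nhds 1) := by
  -- The bound has the exact order `N log³ N`, so no error term is needed.
  refine ⟨10, fun _ => 0, Asymptotics.isLittleO_zero _ _, ?_⟩
  have hcast := tendsto_natCast_atTop_atTop (R := ℝ)
  have hlim : Filter.Tendsto
      (fun N : ℕ => 1 - ((N : ℝ) ^ (-(1 / 8) : ℝ) + (N : ℝ)⁻¹)) Filter.atTop (nhds 1) := by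
    have h1 := (tendsto_rpow_neg_atTop (show (0 : ℝ) < 1 / 8 by norm_num)).comp hcast
    have h2 := tendsto_inv_atTop_zero.comp hcast
    simpa using (h1.add h2).const_sub 1
  refine tendsto_of_tendsto_of_tendsto_of_le_of_le' (hlim.mono_left inf_le_left)
    tendsto_const_nhds ?_ (Filter.Eventually.of_forall fun N => ?_)
  · rw [Filter.eventually_inf_principal]
    filter_upwards [GeodesicFlow.eventually_exists_radius hk, Filter.eventually_gt_atTop k]
      with N ⟨hL, r, h1, h2, h3⟩ hN he
    refine GeodesicFlow.one_sub_le_regularProb (GeodesicFlow.regs_nonempty hN he) h3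
      fun G hG hD => ⟨?_, fun o _ => ?_⟩
    · have : Nonempty (Fin N) := ⟨⟨0, by omega⟩⟩
      refine ⟨fun x y => ?_⟩
      obtain ⟨p, -⟩ := GeodesicFlow.mem_ball_iff.1 (hD x y)
      exact p.reachable
    · rw [add_zero]
      exact GeodesicFlow.maxVertexFlow_lt hk (by omega) hL h1 h2 hG hD o
  · exact GeodesicFlow.regularProb_le_one _ _ _
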